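/- Let $m\ge 0$. On Minkowski spacetime $\mathbb{R}^4$ with coordinates $(t,x,y,z)$ and metric $\mathrm{diag}(-1,1,1,1)$ let $P=\Box-m^2=-\partial_t^2+\partial_x^2+\partial_y^2+\partial_z^2-m^2$. All functions are real-valued. Let $J^{\pm}(p)$ be the causal future ($+$) and past ($-$) of $p$, and $J^\pm(A)=\bigcup_{p\in A}J^\pm(p)$. Let $C^\infty_{tc}(\mathbb{R}^4)$ be the space of timelike compact functions, i.e. of those $\alpha\in C^\infty(\mathbb{R}^4)$ for which $\mathrm{supp}(\alpha)\cap J^-(p)$ and $\mathrm{supp}(\alpha)\cap J^+(p)$ are compact (possibly empty) for all $p\in\mathbb{R}^4$. Let $\iota_z(t,x,y,z)=(t,x,y,-z)$, acting on functions by $\iota_z f=f\circ\iota_z$, and let $C^\infty_{tc,-}(\mathbb{R}^4)=\{\alpha\in C^\infty_{tc}(\mathbb{R}^4) : \iota_z\alpha=-\alpha\}$. Let $E^\pm:C^\infty_{tc}(\mathbb{R}^4)\to C^\infty(\mathbb{R}^4)$ be the advanced and retarded fundamental solutions of $P$: the linear operators such that $P\circ E^\pm$ and $E^\pm\circ P$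 are the identity on $C^\infty_{tc}(\mathbb{R}^4)$ and $\mathrm{supp}(E^\pm\alpha)\subseteq J^\pm(\mathrm{supp}(\alpha))$ for all $\alpha$. Let $E=E^+-E^-$ be the causal propagator. Let $\mathbb{H}^4=\mathbb{R}^3\times[0,\infty)=\{z\ge 0\}$, let $C^\infty(\mathbb{H}^4)$ be the set of functions on $\mathbb{H}^4$ that extend to a smooth function on an open subset of $\mathbb{R}^4$ containing $\mathbb{H}^4$, and let $$\mathcal{S}^{CP}(\mathbb{H}^4)=\{u\in C^\infty(\mathbb{H}^4) : Pu=0 \text{ on } \mathbb{H}^4,\ u=0 \text{ on } \{z=0\}\}.$$ Write $\rho_{\mathbb{H}^4}$ for the restriction of functions to $\mathbb{H}^4$. **Proposition 2.1.** The pair $(E^+,E^-)$ exists and is unique, and $\rho_{\mathbb{H}^4}\circ(E-\iota_z\circ E)$ induces a well-defined bijection $$\frac{C^\infty_{tc,-}(\mathbb{R}^4)}{P\left[C^\infty_{tc,-}(\mathbb{R}^4)\right]}\longrightarrow\mathcal{S}^{CP}(\mathbb{H}^4).$$ -/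

import Mathlib

noncomputable section

namespace CasimirPolder

open scoped ContDiff

/-- Minkowski spacetime `ℝ⁴` with Cartesian coordinates `(t, x, y, z) = (x 0, x 1, x 2, x 3)` and
metric `diag(-1, 1, 1, 1)`. The norm of `Fin 4 → ℝ` is used only through topology and smoothness. -/
abbrev Spacetime : Type := Fin 4 → ℝ

/-! ### Causal structure -/

/-- The causal future `J⁺(p)`: the points `q` such that `q - p` is zero or causal and
future-directed. -/
def causalFuture (p : Spacetime) : Set Spacetime :=
  {q | p 0 ≤ q 0 ∧ (q 1 - p 1) ^ 2 + (q 2 - p 2) ^ 2 + (q 3 - p 3) ^ 2 ≤ (q 0 - p 0) ^ 2}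

/-- The causal past `J⁻(p)`. -/
def causalPast (p : Spacetime) : Set Spacetime :=
  {q | q 0 ≤ p 0 ∧ (q 1 - p 1) ^ 2 + (q 2 - p 2) ^ 2 + (q 3 - p 3) ^ 2 ≤ (q 0 - p 0) ^ 2}

/-- The causal future `J⁺(A)` of a set. -/
def causalFutureSet (A : Set Spacetime) : Set Spacetime := ⋃ p ∈ A, causalFuture p

/-- The causal past `J⁻(A)` of a set. -/
def causalPastSet (A : Set Spacetime) : Set Spacetime := ⋃ p ∈ A, causalPast p

/-! ### The Klein-Gordon operator -/

/-- The partial derivative `∂ᵢ f`. -/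
def partialDeriv (i : Fin 4) (f : Spacetime → ℝ) : Spacetime → ℝ :=
  fun x => fderiv ℝ f x (Pi.single i 1)

/-- `(□ - m²) f`, where `□ = -∂ₜ² + ∂ₓ² + ∂_y² + ∂_z²`, for a function that is `C²` near the point
of evaluation. -/
def kleinGordonFun (m : ℝ) (f : Spacetime → ℝ) : Spacetime → ℝ := fun x =>
  -partialDeriv 0 (partialDeriv 0 f) x + partialDeriv 1 (partialDeriv 1 f) x
    + partialDeriv 2 (partialDeriv 2 f) x + partialDeriv 3 (partialDeriv 3 f) x - m ^ 2 * f x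

/-- The real vector space `C^∞(ℝ⁴)`. -/
def Smooth : Submodule ℝ (Spacetime → ℝ) where
  carrier := {f | ContDiff ℝ ∞ f}
  add_mem' {f g} (hf : ContDiff ℝ ∞ f) (hg : ContDiff ℝ ∞ g) := hf.add hg
  zero_mem' := (contDiff_const : ContDiff ℝ ∞ fun _ : Spacetime => (0 : ℝ))
  smul_mem' c f (hf : ContDiff ℝ ∞ f) := hf.const_smul c

theorem contDiff_partialDeriv (i : Fin 4) {f : Spacetime → ℝ} (hf : ContDiff ℝ ∞ f) :
    ContDiff ℝ ∞ (partialDeriv i f) :=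
  (hf.fderiv_right (m := ∞) (by simp)).clm_apply contDiff_const

theorem partialDeriv_add (i : Fin 4) {f g : Spacetime → ℝ} (hf : ContDiff ℝ ∞ f)
    (hg : ContDiff ℝ ∞ g) :
    partialDeriv i (f + g) = partialDeriv i f + partialDeriv i g := by
  funext x
  have h1 : DifferentiableAt ℝ f x := (hf.differentiable (by simp)) x
  have h2 : DifferentiableAt ℝ g x := (hg.differentiable (by simp)) x
  simp [partialDeriv, fderiv_add h1 h2]

theorem partialDeriv_smul (i : Fin 4) (c : ℝ) {f : Spacetime → ℝ} (hf : ContDiff ℝ ∞ f) :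
    partialDeriv i (c • f) = c • partialDeriv i f := by
  funext x
  have h1 : DifferentiableAt ℝ f x := (hf.differentiable (by simp)) x
  simp [partialDeriv, fderiv_const_smul h1 c]

/-- The operator `P = □ - m²` on `C^∞(ℝ⁴)`. -/
def kleinGordon (m : ℝ) : Smooth →ₗ[ℝ] Smooth where
  toFun f := ⟨kleinGordonFun m f, by
    have h : ∀ i, ContDiff ℝ ∞ (partialDeriv i (partialDeriv i (f : Spacetime → ℝ))) := fun i =>
      contDiff_partialDeriv i (contDiff_partialDeriv i f.2)
    exact (((((h 0).neg).add (h 1)).add (h 2)).add (h 3)).sub (contDiff_const.mul f.2)⟩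
  map_add' f g := by
    apply Subtype.ext
    funext x
    have h : ∀ i, partialDeriv i (partialDeriv i ((f : Spacetime → ℝ) + (g : Spacetime → ℝ)))
        = partialDeriv i (partialDeriv i f) + partialDeriv i (partialDeriv i g) := fun i => by
      rw [partialDeriv_add i f.2 g.2,
        partialDeriv_add i (contDiff_partialDeriv i f.2) (contDiff_partialDeriv i g.2)]
    simp only [kleinGordonFun, Submodule.coe_add, h, Pi.add_apply]
    ring
  map_smul' c f := by
    apply Subtype.ext
    funext x
    have h : ∀ i, partialDeriv i (partialDeriv i (c • (f : Spacetime → ℝ)))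
        = c • partialDeriv i (partialDeriv i f) := fun i => by
      rw [partialDeriv_smul i c f.2, partialDeriv_smul i c (contDiff_partialDeriv i f.2)]
    simp only [kleinGordonFun, Submodule.coe_smul, h, Pi.smul_apply, smul_eq_mul,
      RingHom.id_apply]
    ring

/-! ### Timelike compact functions -/

/-- `f` is timelike compact: its support meets every `J⁺(p)` and every `J⁻(p)` in a compact
(possibly empty) set. -/
def IsTimelikeCompact (f : Spacetime → ℝ) : Prop :=
  ∀ p : Spacetime, IsCompact (tsupport f ∩ causalPast p) ∧ IsCompact (tsupport f ∩ causalFuture p)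

theorem isClosed_causalFuture (p : Spacetime) : IsClosed (causalFuture p) := by
  unfold causalFuture
  rw [Set.ofPred_and]
  exact (isClosed_le (by fun_prop) (by fun_prop)).inter (isClosed_le (by fun_prop) (by fun_prop))

theorem isClosed_causalPast (p : Spacetime) : IsClosed (causalPast p) := by
  unfold causalPast
  rw [Set.ofPred_and]
  exact (isClosed_le (by fun_prop) (by fun_prop)).inter (isClosed_le (by fun_prop) (by fun_prop))

theorem IsTimelikeCompact.mono {f g : Spacetime → ℝ} (hf : IsTimelikeCompact f)
    (h : tsupport g ⊆ tsupport f) : IsTimelikeCompact g := fun p =>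
  ⟨(hf p).1.of_isClosed_subset ((isClosed_tsupport g).inter (isClosed_causalPast p))
      (Set.inter_subset_inter_left _ h),
    (hf p).2.of_isClosed_subset ((isClosed_tsupport g).inter (isClosed_causalFuture p))
      (Set.inter_subset_inter_left _ h)⟩

theorem IsTimelikeCompact.add {f g : Spacetime → ℝ} (hf : IsTimelikeCompact f)
    (hg : IsTimelikeCompact g) : IsTimelikeCompact (f + g) := fun p => by
  have h : tsupport (f + g) ⊆ tsupport f ∪ tsupport g := tsupport_add f g
  constructor
  · refine ((hf p).1.union (hg p).1).of_isClosed_subset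
      ((isClosed_tsupport _).inter (isClosed_causalPast p)) ?_
    rw [← Set.union_inter_distrib_right]
    exact Set.inter_subset_inter_left _ h
  · refine ((hf p).2.union (hg p).2).of_isClosed_subset
      ((isClosed_tsupport _).inter (isClosed_causalFuture p)) ?_
    rw [← Set.union_inter_distrib_right]
    exact Set.inter_subset_inter_left _ h

/-- The space `C^∞_tc(ℝ⁴)`. -/
def TimelikeCompact : Submodule ℝ (Spacetime → ℝ) where
  carrier := {f | f ∈ Smooth ∧ IsTimelikeCompact f}
  add_mem' hf hg := ⟨Smooth.add_mem hf.1 hg.1, hf.2.add hg.2⟩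
  zero_mem' := ⟨Smooth.zero_mem, fun p => by simp [tsupport]⟩
  smul_mem' c f hf := ⟨Smooth.smul_mem c hf.1,
    hf.2.mono (closure_mono (Function.support_const_smul_subset c f))⟩

theorem timelikeCompact_le_smooth : TimelikeCompact ≤ Smooth := fun _ hf => hf.1

theorem tsupport_partialDeriv_subset (i : Fin 4) (f : Spacetime → ℝ) :
    tsupport (partialDeriv i f) ⊆ tsupport f :=
  tsupport_fderiv_apply_subset ℝ (Pi.single i 1)

theorem tsupport_kleinGordonFun_subset (m : ℝ) (f : Spacetime → ℝ) :
    tsupport (kleinGordonFun m f) ⊆ tsupport f := by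
  refine closure_minimal (fun x hx => ?_) (isClosed_tsupport f)
  by_contra hxf
  have h : ∀ i, partialDeriv i (partialDeriv i f) x = 0 := fun i =>
    image_eq_zero_of_notMem_tsupport fun hx' =>
      hxf (tsupport_partialDeriv_subset i f (tsupport_partialDeriv_subset i _ hx'))
  exact hx (by simp [kleinGordonFun, h, image_eq_zero_of_notMem_tsupport hxf])

theorem kleinGordonFun_mem_timelikeCompact (m : ℝ) {f : Spacetime → ℝ}
    (hf : f ∈ TimelikeCompact) : kleinGordonFun m f ∈ TimelikeCompact :=
  ⟨(kleinGordon m ⟨f, hf.1⟩).2, hf.2.mono (tsupport_kleinGordonFun_subset m f)⟩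

/-- The operator `P` on `C^∞_tc(ℝ⁴)`. -/
def kleinGordonTC (m : ℝ) : TimelikeCompact →ₗ[ℝ] TimelikeCompact :=
  (Smooth.subtype ∘ₗ kleinGordon m ∘ₗ Submodule.inclusion timelikeCompact_le_smooth).codRestrict
    TimelikeCompact (fun f => kleinGordonFun_mem_timelikeCompact m f.2)

/-! ### Advanced and retarded fundamental solutions and the causal propagator -/

/-- A linear operator `G : C^∞_tc(ℝ⁴) → C^∞(ℝ⁴)` such that `P ∘ G` and `G ∘ P` are the identity on
`C^∞_tc(ℝ⁴)` and `supp (G α) ⊆ J (supp α)`. -/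
structure IsFundamentalSolution (m : ℝ) (J : Set Spacetime → Set Spacetime)
    (G : TimelikeCompact →ₗ[ℝ] Smooth) : Prop where
  kleinGordon_apply : ∀ α : TimelikeCompact,
    (kleinGordon m (G α) : Spacetime → ℝ) = (α : Spacetime → ℝ)
  apply_kleinGordon : ∀ α : TimelikeCompact,
    (G (kleinGordonTC m α) : Spacetime → ℝ) = (α : Spacetime → ℝ)
  support_subset : ∀ α : TimelikeCompact,
    tsupport (G α : Spacetime → ℝ) ⊆ J (tsupport (α : Spacetime → ℝ))

/-- `G = (E⁺, E⁻)`, the operator `E⁺` propagating to the causal future and `E⁻` to the causal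
past. -/
def IsFundamentalPair (m : ℝ)
    (G : (TimelikeCompact →ₗ[ℝ] Smooth) × (TimelikeCompact →ₗ[ℝ] Smooth)) : Prop :=
  IsFundamentalSolution m causalFutureSet G.1 ∧ IsFundamentalSolution m causalPastSet G.2

open Classical in
/-- The pair `(E⁺, E⁻)` of fundamental solutions of `P`, as a definite description. -/
def fundamentalPair (m : ℝ) :
    (TimelikeCompact →ₗ[ℝ] Smooth) × (TimelikeCompact →ₗ[ℝ] Smooth) :=
  if h : ∃ G, IsFundamentalPair m G then h.choose else 0

/-- The causal propagator `E = E⁺ - E⁻`. -/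
def causalPropagator (m : ℝ) : TimelikeCompact →ₗ[ℝ] Smooth :=
  (fundamentalPair m).1 - (fundamentalPair m).2

theorem causalPropagator_kleinGordonTC (m : ℝ) (α : TimelikeCompact) :
    causalPropagator m (kleinGordonTC m α) = 0 := by
  unfold causalPropagator fundamentalPair
  split_ifs with h
  · rw [LinearMap.sub_apply, sub_eq_zero]
    exact Subtype.ext ((h.choose_spec.1.apply_kleinGordon α).trans
      (h.choose_spec.2.apply_kleinGordon α).symm)
  · simp

/-! ### Reflection along `z = 0` -/

/-- The isometry `ι_z : (t, x, y, z) ↦ (t, x, y, -z)`. -/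
def reflect (x : Spacetime) : Spacetime := ![x 0, x 1, x 2, -x 3]

theorem contDiff_reflect : ContDiff ℝ ∞ reflect := by
  rw [contDiff_pi]
  intro i
  fin_cases i <;> simp [reflect] <;> fun_prop

/-- The action `f ↦ f ∘ ι_z` of the reflection on `C^∞(ℝ⁴)`. -/
def reflectFun : Smooth →ₗ[ℝ] Smooth where
  toFun f := ⟨fun x => (f : Spacetime → ℝ) (reflect x), ContDiff.comp (show ContDiff ℝ ∞ (f : Spacetime → ℝ) from f.2) contDiff_reflect⟩
  map_add' _ _ := rfl
  map_smul' _ _ := rfl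

/-- The space `C^∞_-(ℝ⁴)` of smooth functions that are odd under `z ↦ -z`. -/
def Odd : Submodule ℝ (Spacetime → ℝ) where
  carrier := {f | f ∈ Smooth ∧ ∀ x, f x = -f (reflect x)}
  add_mem' {f g} hf hg := ⟨Smooth.add_mem hf.1 hg.1, fun x => by
    rw [Pi.add_apply, Pi.add_apply, hf.2 x, hg.2 x]
    ring⟩
  zero_mem' := ⟨Smooth.zero_mem, fun x => by simp⟩
  smul_mem' c f hf := ⟨Smooth.smul_mem c hf.1, fun x => by
    rw [Pi.smul_apply, Pi.smul_apply, hf.2 x, smul_neg]⟩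

/-- The space `C^∞_{tc,-}(ℝ⁴)` of odd timelike compact functions. -/
def TimelikeCompactOdd : Submodule ℝ (Spacetime → ℝ) := TimelikeCompact ⊓ Odd

/-- The inclusion of `C^∞_{tc,-}(ℝ⁴)` into `C^∞_tc(ℝ⁴)`. -/
def inclTC : TimelikeCompactOdd →ₗ[ℝ] TimelikeCompact := Submodule.inclusion inf_le_left

/-- `reflect` as a linear map. -/
def reflectL : Spacetime →L[ℝ] Spacetime :=
  LinearMap.toContinuousLinearMap
    { toFun := reflect
      map_add' := fun x y => by
        funext i
        fin_cases i <;> simp [reflect]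
        ring
      map_smul' := fun c x => by
        funext i
        fin_cases i <;> simp [reflect] }

theorem partialDeriv_comp_reflect (i : Fin 4) {f : Spacetime → ℝ} (hf : ContDiff ℝ ∞ f)
    (x : Spacetime) :
    partialDeriv i (fun y => f (reflect y)) x
      = (if i = 3 then -1 else 1) * partialDeriv i f (reflect x) := by
  have h1 : HasFDerivAt f (fderiv ℝ f (reflect x)) (reflect x) :=
    ((hf.differentiable (by simp)) (reflect x)).hasFDerivAt
  have h2 : HasFDerivAt reflect reflectL x := reflectL.hasFDerivAt
  have h3 : fderiv ℝ (fun y => f (reflect y)) x = (fderiv ℝ f (reflect x)).comp reflectL :=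
    (h1.comp x h2).fderiv
  have h4 : reflectL (Pi.single i 1)
      = ((if i = 3 then -1 else 1 : ℝ)) • (Pi.single i 1 : Spacetime) := by
    change reflect (Pi.single i 1) = _
    funext j
    fin_cases i <;> fin_cases j <;> simp [reflect]
  rw [partialDeriv, h3, ContinuousLinearMap.comp_apply, h4, map_smul, smul_eq_mul, partialDeriv]

theorem kleinGordonFun_comp_reflect (m : ℝ) {f : Spacetime → ℝ} (hf : ContDiff ℝ ∞ f)
    (x : Spacetime) :
    kleinGordonFun m (fun y => f (reflect y)) x = kleinGordonFun m f (reflect x) := by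
  have h : ∀ i, partialDeriv i (partialDeriv i (fun y => f (reflect y))) x
      = partialDeriv i (partialDeriv i f) (reflect x) := fun i => by
    have h1 : partialDeriv i (fun y => f (reflect y))
        = (if i = 3 then -1 else 1 : ℝ) • fun y => partialDeriv i f (reflect y) := by
      funext y
      rw [partialDeriv_comp_reflect i hf y, Pi.smul_apply, smul_eq_mul]
    have h2 := (contDiff_partialDeriv i hf)
    rw [h1, partialDeriv_smul i _ (f := fun y => partialDeriv i f (reflect y)) (h2.comp contDiff_reflect), Pi.smul_apply, smul_eq_mul,
      partialDeriv_comp_reflect i h2 x, ← mul_assoc]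
    split_ifs <;> simp
  simp only [kleinGordonFun, h]

theorem kleinGordonFun_mem_timelikeCompactOdd (m : ℝ) {f : Spacetime → ℝ}
    (hf : f ∈ TimelikeCompactOdd) : kleinGordonFun m f ∈ TimelikeCompactOdd := by
  have hf1 := kleinGordonFun_mem_timelikeCompact m hf.1
  refine ⟨hf1, hf1.1, fun x => ?_⟩
  have hfs : ContDiff ℝ ∞ f := hf.1.1
  have h : (⟨f, hf.1.1⟩ : Smooth) = (-1 : ℝ) • reflectFun ⟨f, hf.1.1⟩ :=
    Subtype.ext (funext fun y => by
      change f y = (-1 : ℝ) * f (reflect y)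
      rw [neg_one_mul]
      exact hf.2.2 y)
  have h2 := congrArg (kleinGordon m) h
  rw [map_smul] at h2
  have h3 := congrFun (congrArg Subtype.val h2) x
  change kleinGordonFun m f x = (-1 : ℝ) * kleinGordonFun m (fun y => f (reflect y)) x at h3
  rw [h3, kleinGordonFun_comp_reflect m hfs x, neg_one_mul]

/-- The operator `P` on `C^∞_{tc,-}(ℝ⁴)`. -/
def kleinGordonTCOdd (m : ℝ) : TimelikeCompactOdd →ₗ[ℝ] TimelikeCompactOdd :=
  (TimelikeCompact.subtype ∘ₗ kleinGordonTC m ∘ₗ inclTC).codRestrict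
    TimelikeCompactOdd (fun f => kleinGordonFun_mem_timelikeCompactOdd m f.2)

/-! ### The half-space and the Dirichlet problem -/

/-- The half-space `ℍ⁴ = ℝ³ × [0, ∞)`. -/
def halfSpace : Set Spacetime := {x | 0 ≤ x 3}

/-- `v` is a smooth extension of `u : ℍ⁴ → ℝ` to the open neighbourhood `O` of `ℍ⁴`. -/
structure IsSmoothExtension (u : halfSpace → ℝ) (O : Set Spacetime) (v : Spacetime → ℝ) :
    Prop where
  isOpen : IsOpen O
  subset : halfSpace ⊆ O
  contDiffOn : ContDiffOn ℝ ∞ v O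
  eq : ∀ x : halfSpace, v x = u x

/-- The dynamical configurations: the `u ∈ C^∞(ℍ⁴)`, i.e. the functions on `ℍ⁴` with a smooth
extension to an open neighbourhood, such that `P u = 0` on `ℍ⁴` and `u = 0` on `z = 0`. The
derivatives of `u` on `ℍ⁴` are those of an extension; by continuity from the interior they do not
depend on which one is taken. -/
def dynamicalConfigurations (m : ℝ) : Set (halfSpace → ℝ) :=
  {u | (∃ O v, IsSmoothExtension u O v ∧ ∀ x ∈ halfSpace, kleinGordonFun m v x = 0) ∧
    ∀ x : halfSpace, (x : Spacetime) 3 = 0 → u x = 0}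

/-- The restriction map `ρ` from `C^∞(ℝ⁴)` to functions on `ℍ⁴`. -/
def restrictHalfSpace : Smooth →ₗ[ℝ] (halfSpace → ℝ) where
  toFun f := fun x => (f : Spacetime → ℝ) x
  map_add' _ _ := rfl
  map_smul' _ _ := rfl

/-! ### The method of images -/

/-- The map `ρ ∘ (E - ι_z ∘ E)` on `C^∞_tc(ℝ⁴)`. -/
def imagesOperator (m : ℝ) : TimelikeCompact →ₗ[ℝ] (halfSpace → ℝ) :=
  restrictHalfSpace ∘ₗ (causalPropagator m - reflectFun ∘ₗ causalPropagator m)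

theorem range_le_ker (m : ℝ) :
    LinearMap.range (kleinGordonTCOdd m) ≤ LinearMap.ker (imagesOperator m ∘ₗ inclTC) := by
  rintro _ ⟨α, rfl⟩
  have h : inclTC (kleinGordonTCOdd m α) = kleinGordonTC m (inclTC α) := rfl
  simp [LinearMap.mem_ker, imagesOperator, h, causalPropagator_kleinGordonTC]

/-- The map induced by `ρ ∘ (E - ι_z ∘ E)` on `C^∞_{tc,-}(ℝ⁴) / P[C^∞_{tc,-}(ℝ⁴)]`. -/
def imagesMap (m : ℝ) :
    (TimelikeCompactOdd ⧸ LinearMap.range (kleinGordonTCOdd m)) →ₗ[ℝ] (halfSpace → ℝ) :=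
  (LinearMap.range (kleinGordonTCOdd m)).liftQ (imagesOperator m ∘ₗ inclTC) (range_le_ker m)

end CasimirPolder

end

/-!
The fundamental solutions of `P = □ - m²` are constructed explicitly, and the bijection then follows
from uniqueness of solutions with past or future compact support.

*The wave operator.* The retarded potential `K f` (`wavePotential`) is the integral of `f` over the
past light cone. In polar coordinates its density is smooth, so that `K` commutes with derivatives
(`hasFDerivAt_wavePotential`), and there `□f` is a divergence, which gives `K □ f = -f` for test
functions (`wavePotential_wave`). The sign `ε = ±1` selects the retarded or the advanced case.

*The mass term.* In the norm `sup |f| e^{-λεt}` the operator `K` has norm at most `λ⁻²`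
(`ExpBound.contraction`). Hence, for `λ > |m|`, the Neumann series `-∑ₖ (-m²)ᵏ Kᵏ⁺¹ f` (`potential`)
converges together with all its derivatives, and it inverts `P` on test functions from both sides.

*Supports.* The value of `potential` at `p` depends only on `f` on the past cone of `p`
(`potential_congr`). A smooth function whose support meets every past cone in a compact set agrees
on a given past cone with a test function, so the two inversion formulas extend to all such
functions. In particular a solution of `P u = f` with past compact support is unique
(`eq_of_kleinGordonFun_eq`), and this proves existence and uniqueness of `(E⁺, E⁻)`.

*The bijection.* For odd `α` the function `E α` is odd by uniqueness, so `(E - ι_z E) α = 2 E α`. If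
it vanishes on the half-space, then `E⁺ α = E⁻ α` everywhere; its support is past and future
compact, so `α = P (E⁺ α)` is in the image of `P` (`ker_imagesOperator_le`). Conversely the odd
extension `w` of a Dirichlet solution is smooth (`contDiff_reflectExt`) and solves `P w = 0`. If `χ`
is a function of time that switches from `0` to `1`, then `α = P (χ w) = P ((χ - 1) w)` is timelike
compact, and by uniqueness `E⁺ α = χ w` and `E⁻ α = (χ - 1) w`, so `E α = w`
(`exists_causalPropagator_eq`).
-/

noncomputable section

namespace CasimirPolder

open MeasureTheory Set Filter Topology
open scoped ContDiff

/-! ### Calculus with partial derivatives -/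

/-- The covector `∑ᵢ aᵢ dxᵢ`. -/
def covector (a : Fin 4 → ℝ) : Spacetime →L[ℝ] ℝ :=
  ∑ i, a i • ContinuousLinearMap.proj (R := ℝ) (φ := fun _ : Fin 4 => ℝ) i

theorem covector_apply (a : Fin 4 → ℝ) (v : Spacetime) : covector a v = ∑ i, a i * v i := by
  simp [covector]

theorem norm_covector_le (a : Fin 4 → ℝ) : ‖covector a‖ ≤ ∑ i, |a i| := by
  refine ContinuousLinearMap.opNorm_le_bound _ (by positivity) fun v => ?_
  rw [covector_apply, Finset.sum_mul]
  refine (norm_sum_le _ _).trans (Finset.sum_le_sum fun i _ => ?_)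
  rw [norm_mul, Real.norm_eq_abs]
  gcongr
  exact norm_le_pi_norm v i

theorem eq_covector (D : Spacetime →L[ℝ] ℝ) : D = covector fun i => D (Pi.single i 1) := by
  ext v
  rw [covector_apply]
  conv_lhs => rw [← Finset.univ_sum_single v, map_sum]
  refine Finset.sum_congr rfl fun i _ => ?_
  rw [mul_comm, ← smul_eq_mul, ← map_smul, ← Pi.single_smul, smul_eq_mul, mul_one]

theorem hasFDerivAt_covector {f : Spacetime → ℝ} {x : Spacetime} (hf : DifferentiableAt ℝ f x) :
    HasFDerivAt f (covector fun i => partialDeriv i f x) x := by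
  have h := hf.hasFDerivAt
  rwa [eq_covector (fderiv ℝ f x)] at h

theorem partialDeriv_eq_of_hasFDerivAt {f : Spacetime → ℝ} {a : Fin 4 → ℝ} {x : Spacetime}
    (h : HasFDerivAt f (covector a) x) (i : Fin 4) : partialDeriv i f x = a i := by
  rw [partialDeriv, h.fderiv, covector_apply]
  simp [Pi.single_apply]

/-- A family of functions that contains the partial derivatives of its members consists of smooth
functions. -/
theorem contDiff_of_forall_hasFDerivAt (F : Set (Spacetime → ℝ))
    (hF : ∀ f ∈ F, ∃ g : Fin 4 → Spacetime → ℝ, (∀ i, g i ∈ F) ∧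
      ∀ x, HasFDerivAt f (covector fun i => g i x) x) {f : Spacetime → ℝ} (hf : f ∈ F) :
    ContDiff ℝ ∞ f := by
  have key : ∀ n : ℕ, ∀ f ∈ F, ContDiff ℝ n f := by
    intro n
    induction n with
    | zero =>
      intro f hf
      obtain ⟨g, -, hg⟩ := hF f hf
      exact contDiff_zero.2 (continuous_iff_continuousAt.2 fun x => (hg x).continuousAt)
    | succ n ih =>
      intro f hf
      obtain ⟨g, hgF, hg⟩ := hF f hf
      have := (contDiff_succ_iff_hasFDerivAt (n := n) (f := f)).2
        ⟨fun x => covector fun i => g i x, ?_, hg⟩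
      · exact_mod_cast this
      · exact ContDiff.sum fun i _ => (ih _ (hgF i)).smul contDiff_const
  exact contDiff_infty.2 fun n => key n f hf

theorem differentiable_of_contDiff {f : Spacetime → ℝ} (hf : ContDiff ℝ ∞ f) :
    Differentiable ℝ f := hf.differentiable (by simp)

theorem partialDeriv_comm {f : Spacetime → ℝ} (hf : ContDiff ℝ ∞ f) (i j : Fin 4) (x : Spacetime) :
    partialDeriv i (partialDeriv j f) x = partialDeriv j (partialDeriv i f) x := by
  have hd : DifferentiableAt ℝ (fderiv ℝ f) x :=
    (hf.fderiv_right (m := ∞) (by simp)).differentiable (by simp) x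
  have h : ∀ a b : Fin 4, partialDeriv a (partialDeriv b f) x
      = fderiv ℝ (fderiv ℝ f) x (Pi.single a 1) (Pi.single b 1) := fun a b => by
    have := hd.hasFDerivAt.clm_apply (hasFDerivAt_const (Pi.single b 1 : Spacetime) x)
    change fderiv ℝ (fun y => fderiv ℝ f y (Pi.single b 1)) x _ = _
    rw [this.fderiv]
    simp
  rw [h, h]
  refine (hf.contDiffAt.isSymmSndFDerivAt ?_) _ _
  rw [minSmoothness_of_isRCLikeNormedField]
  exact ENat.LEInfty.out

theorem _root_.Filter.EventuallyEq.partialDeriv {f g : Spacetime → ℝ} {x : Spacetime}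
    (h : f =ᶠ[𝓝 x] g) (i : Fin 4) : partialDeriv i f =ᶠ[𝓝 x] partialDeriv i g := by
  filter_upwards [h.eventuallyEq_nhds] with y hy
  simp only [CasimirPolder.partialDeriv, hy.fderiv_eq]

theorem _root_.Filter.EventuallyEq.kleinGordonFun_eq (m : ℝ) {f g : Spacetime → ℝ} {x : Spacetime}
    (h : f =ᶠ[𝓝 x] g) : kleinGordonFun m f x = kleinGordonFun m g x := by
  have h2 : ∀ i, CasimirPolder.partialDeriv i (CasimirPolder.partialDeriv i f) x
      = CasimirPolder.partialDeriv i (CasimirPolder.partialDeriv i g) x :=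
    fun i => ((h.partialDeriv i).partialDeriv i).eq_of_nhds
  simp only [kleinGordonFun, h2, h.eq_of_nhds]

theorem contDiff_kleinGordonFun (m : ℝ) {f : Spacetime → ℝ} (hf : ContDiff ℝ ∞ f) :
    ContDiff ℝ ∞ (kleinGordonFun m f) := (kleinGordon m ⟨f, hf⟩).2

theorem kleinGordonFun_sub (m : ℝ) {f g : Spacetime → ℝ} (hf : ContDiff ℝ ∞ f)
    (hg : ContDiff ℝ ∞ g) (x : Spacetime) :
    kleinGordonFun m (f - g) x = kleinGordonFun m f x - kleinGordonFun m g x :=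
  congrFun (congrArg Subtype.val ((kleinGordon m).map_sub ⟨f, hf⟩ ⟨g, hg⟩)) x

theorem kleinGordonFun_neg (m : ℝ) {f : Spacetime → ℝ} (hf : ContDiff ℝ ∞ f) (x : Spacetime) :
    kleinGordonFun m (-f) x = -kleinGordonFun m f x :=
  congrFun (congrArg Subtype.val ((kleinGordon m).map_neg ⟨f, hf⟩)) x

/-! ### Light cones -/

/-- The causal future (`ε = 1`) or past (`ε = -1`) of `p`. The sign `ε` lets both time orientations
be treated at once. -/
def cone (ε : ℝ) (p : Spacetime) : Set Spacetime :=
  {q | 0 ≤ ε * (q 0 - p 0) ∧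
    (q 1 - p 1) ^ 2 + (q 2 - p 2) ^ 2 + (q 3 - p 3) ^ 2 ≤ (q 0 - p 0) ^ 2}

theorem causalFuture_eq_cone : causalFuture = cone 1 := by
  ext p q
  simp [causalFuture, cone]

theorem causalPast_eq_cone : causalPast = cone (-1) := by
  ext p q
  simp [causalPast, cone]

variable {ε : ℝ}

theorem mem_cone_neg_iff {p q : Spacetime} : q ∈ cone (-ε) p ↔ p ∈ cone ε q := by
  simp only [cone, mem_ofPred_eq]
  refine and_congr ?_ ?_
  · rw [show -ε * (q 0 - p 0) = ε * (p 0 - q 0) by ring]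
  · rw [show (q 0 - p 0) ^ 2 = (p 0 - q 0) ^ 2 by ring,
      show (q 1 - p 1) ^ 2 = (p 1 - q 1) ^ 2 by ring,
      show (q 2 - p 2) ^ 2 = (p 2 - q 2) ^ 2 by ring,
      show (q 3 - p 3) ^ 2 = (p 3 - q 3) ^ 2 by ring]

theorem self_mem_cone (p : Spacetime) : p ∈ cone ε p := by simp [cone]

theorem cone_trans (hε : ε ^ 2 = 1) {p q r : Spacetime} (h1 : q ∈ cone ε p) (h2 : r ∈ cone ε q) :
    r ∈ cone ε p := by
  obtain ⟨h1t, h1s⟩ := h1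
  obtain ⟨h2t, h2s⟩ := h2
  refine ⟨by linarith, ?_⟩
  have hcs : ((q 1 - p 1) * (r 1 - q 1) + (q 2 - p 2) * (r 2 - q 2) + (q 3 - p 3) * (r 3 - q 3)) ^ 2
      ≤ ((ε * (q 0 - p 0)) * (ε * (r 0 - q 0))) ^ 2 := by
    have e : ((ε * (q 0 - p 0)) * (ε * (r 0 - q 0))) ^ 2
        = (q 0 - p 0) ^ 2 * (r 0 - q 0) ^ 2 := by
      linear_combination (ε ^ 2 + 1) * (q 0 - p 0) ^ 2 * (r 0 - q 0) ^ 2 * hε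
    rw [e]
    refine le_trans ?_ (mul_le_mul h1s h2s (by positivity) (by positivity))
    nlinarith [sq_nonneg ((q 1 - p 1) * (r 2 - q 2) - (q 2 - p 2) * (r 1 - q 1)),
      sq_nonneg ((q 1 - p 1) * (r 3 - q 3) - (q 3 - p 3) * (r 1 - q 1)),
      sq_nonneg ((q 2 - p 2) * (r 3 - q 3) - (q 3 - p 3) * (r 2 - q 2))]
  have h3 := abs_le_of_sq_le_sq hcs (mul_nonneg h1t h2t)
  have e2 : (ε * (q 0 - p 0)) * (ε * (r 0 - q 0)) = (q 0 - p 0) * (r 0 - q 0) := by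
    linear_combination (q 0 - p 0) * (r 0 - q 0) * hε
  rw [e2] at h3
  nlinarith [(abs_le.1 h3).2]

theorem isClosed_cone (p : Spacetime) : IsClosed (cone ε p) := by
  unfold cone
  rw [Set.ofPred_and]
  exact (isClosed_le (by fun_prop) (by fun_prop)).inter (isClosed_le (by fun_prop) (by fun_prop))

/-- The point `p + ε ∂ₜ`, in whose past (`ε = 1`) or future (`ε = -1`) `p` is an interior point. -/
def later (ε : ℝ) (p : Spacetime) : Spacetime := p + Pi.single 0 ε

theorem cone_later_mem_nhds (hε : ε ^ 2 = 1) {p x : Spacetime} (hx : x ∈ cone (-ε) p) :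
    cone (-ε) (later ε p) ∈ 𝓝 x := by
  have hε' : (-ε) ^ 2 = 1 := by rw [neg_sq, hε]
  have h1 : later ε x ∈ cone (-ε) (later ε p) := by
    obtain ⟨ha, hb⟩ := hx
    exact ⟨by simpa [later] using ha, by simpa [later] using hb⟩
  have h2 : {y : Spacetime | 0 < -ε * (y 0 - later ε x 0) ∧
      (y 1 - later ε x 1) ^ 2 + (y 2 - later ε x 2) ^ 2 + (y 3 - later ε x 3) ^ 2
        < (y 0 - later ε x 0) ^ 2} ∈ 𝓝 x := by
    refine IsOpen.mem_nhds ?_ ?_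
    · rw [Set.ofPred_and]
      exact (isOpen_lt (by fun_prop) (by fun_prop)).inter (isOpen_lt (by fun_prop) (by fun_prop))
    · constructor
      · simp [later, ← sq, hε]
      · simp [later, hε]
  filter_upwards [h2] with y hy
  exact cone_trans hε' h1 ⟨hy.1.le, hy.2.le⟩

/-- The causal future (`ε = 1`) or past (`ε = -1`) of a set. -/
def coneSet (ε : ℝ) (A : Set Spacetime) : Set Spacetime := ⋃ p ∈ A, cone ε p

theorem causalFutureSet_eq_coneSet : causalFutureSet = coneSet 1 := by
  funext A
  simp [causalFutureSet, coneSet, causalFuture_eq_cone]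

theorem causalPastSet_eq_coneSet : causalPastSet = coneSet (-1) := by
  funext A
  simp [causalPastSet, coneSet, causalPast_eq_cone]

theorem mem_coneSet {A : Set Spacetime} {x : Spacetime} :
    x ∈ coneSet ε A ↔ ∃ a ∈ A, x ∈ cone ε a := by simp [coneSet]

/-- `A` meets every causal past (`ε = 1`) or every causal future (`ε = -1`) in a compact set. -/
def PastCompact (ε : ℝ) (A : Set Spacetime) : Prop := ∀ q, IsCompact (A ∩ cone (-ε) q)

theorem PastCompact.mono {A B : Set Spacetime} (hA : PastCompact ε A) (hB : IsClosed B)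
    (h : B ⊆ A) : PastCompact ε B := fun q =>
  (hA q).of_isClosed_subset (hB.inter (isClosed_cone q)) (inter_subset_inter_left _ h)

theorem isTimelikeCompact_iff {f : Spacetime → ℝ} :
    IsTimelikeCompact f ↔ PastCompact 1 (tsupport f) ∧ PastCompact (-1) (tsupport f) := by
  simp only [IsTimelikeCompact, PastCompact, causalPast_eq_cone, causalFuture_eq_cone, neg_neg,
    forall_and]

/-- A part of a past cone on which time is bounded below is bounded, because the time slices of the
cone are balls. -/
theorem isCompact_of_subset_cone (hε : ε ^ 2 = 1) {A : Set Spacetime} (hA : IsClosed A)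
    {q : Spacetime} (hAq : A ⊆ cone (-ε) q) {T : ℝ} (hT : ∀ x ∈ A, T ≤ ε * x 0) : IsCompact A := by
  refine Metric.isCompact_of_isClosed_isBounded hA ?_
  refine (Metric.isBounded_closedBall (x := q) (r := max (ε * q 0 - T) 0)).subset fun x hx => ?_
  rw [Metric.mem_closedBall, dist_eq_norm, pi_norm_le_iff_of_nonneg (le_max_right _ _)]
  obtain ⟨h1, h2⟩ := hAq hx
  have h3 := hT x hx
  have h0 : (x 0 - q 0) ^ 2 ≤ (ε * q 0 - T) ^ 2 := by
    have : (x 0 - q 0) ^ 2 = (ε * (q 0 - x 0)) ^ 2 := by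
      linear_combination (-(q 0 - x 0) ^ 2) * hε
    rw [this]
    exact pow_le_pow_left₀ (by linarith) (by linarith) 2
  have h5 : 0 ≤ ε * q 0 - T := by linarith
  intro i
  rw [Real.norm_eq_abs, Pi.sub_apply]
  refine le_trans (abs_le_of_sq_le_sq ?_ h5) (le_max_left _ _)
  fin_cases i
  · exact h0
  all_goals
    simp only [Fin.mk_one, Fin.reduceFinMk]
    nlinarith [sq_nonneg (x 1 - q 1), sq_nonneg (x 2 - q 2), sq_nonneg (x 3 - q 3)]

theorem pastCompact_of_le (hε : ε ^ 2 = 1) {A : Set Spacetime} (hA : IsClosed A) {T : ℝ}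
    (hT : ∀ x ∈ A, T ≤ ε * x 0) : PastCompact ε A := fun q =>
  isCompact_of_subset_cone hε (hA.inter (isClosed_cone q)) inter_subset_right
    fun x hx => hT x hx.1

theorem PastCompact.isClosed_coneSet (hε : ε ^ 2 = 1) {A : Set Spacetime} (hA : PastCompact ε A) :
    IsClosed (coneSet ε A) := by
  refine IsSeqClosed.isClosed fun u x hu hux => ?_
  have hev := hux.eventually (cone_later_mem_nhds hε (self_mem_cone x))
  choose a haA hau using fun n => mem_coneSet.1 (hu n)
  have hε' : (-ε) ^ 2 = 1 := by rw [neg_sq, hε]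
  have ha : ∀ᶠ n in atTop, a n ∈ A ∩ cone (-ε) (later ε x) := by
    filter_upwards [hev] with n hn
    exact ⟨haA n, cone_trans hε' hn (mem_cone_neg_iff.2 (hau n))⟩
  obtain ⟨b, hb, φ, hφ, hlim⟩ := (hA (later ε x)).tendsto_subseq' ha.frequently
  refine mem_coneSet.2 ⟨b, hb.1, ?_⟩
  have hclosed : IsClosed {z : Spacetime × Spacetime | z.2 ∈ cone ε z.1} := by
    simp only [cone, mem_ofPred_eq]
    rw [Set.ofPred_and]
    exact (isClosed_le (by fun_prop) (by fun_prop)).inter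
      (isClosed_le (by fun_prop) (by fun_prop))
  exact hclosed.mem_of_tendsto (hlim.prodMk_nhds (hux.comp hφ.tendsto_atTop))
    (Eventually.of_forall fun n => hau (φ n))

theorem PastCompact.coneSet (hε : ε ^ 2 = 1) {A : Set Spacetime} (hA : PastCompact ε A) :
    PastCompact ε (coneSet ε A) := by
  intro q
  have hε' : (-ε) ^ 2 = 1 := by rw [neg_sq, hε]
  obtain ⟨T, hT⟩ := ((hA q).image (f := fun x => ε * x 0) (by fun_prop)).bddBelow
  refine isCompact_of_subset_cone (T := T) hε ((hA.isClosed_coneSet hε).inter (isClosed_cone q))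
    inter_subset_right fun x hx => ?_
  obtain ⟨a, haA, hax⟩ := mem_coneSet.1 hx.1
  have := hT ⟨a, ⟨haA, cone_trans hε' hx.2 (mem_cone_neg_iff.2 hax)⟩, rfl⟩
  have h2 := hax.1
  simp only at this
  linarith

/-- A smooth function with past compact support agrees with a test function on any given past
cone. -/
theorem exists_hasCompactSupport_eqOn_cone {f : Spacetime → ℝ} (hf : ContDiff ℝ ∞ f)
    {q : Spacetime} (hq : IsCompact (tsupport f ∩ cone (-ε) q)) :
    ∃ g : Spacetime → ℝ, ContDiff ℝ ∞ g ∧ HasCompactSupport g ∧ EqOn f g (cone (-ε) q) := by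
  obtain ⟨R, hR⟩ := hq.isBounded.subset_closedBall (0 : Spacetime)
  let χ : ContDiffBump (0 : Spacetime) := ⟨max R 1, max R 1 + 1, by positivity, by linarith⟩
  refine ⟨fun x => χ x * f x, χ.contDiff.mul hf, χ.hasCompactSupport.mul_right, fun x hx => ?_⟩
  by_cases hxf : x ∈ tsupport f
  · have := χ.one_of_mem_closedBall
      (Metric.closedBall_subset_closedBall (le_max_left R 1) (hR ⟨hxf, hx⟩))
    simp [this]
  · simp [image_eq_zero_of_notMem_tsupport hxf]

/-! ### The retarded and advanced potentials of the wave operator -/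

/-- The point of the light cone of the origin with polar coordinates `(r, θ, φ)`. -/
def lightVec (ε : ℝ) (s : ℝ × ℝ × ℝ) : Spacetime :=
  ![ε * s.1, s.1 * (Real.sin s.2.1 * Real.cos s.2.2), s.1 * (Real.sin s.2.1 * Real.sin s.2.2),
    s.1 * Real.cos s.2.1]

/-- Lebesgue measure on the domain of the polar coordinates `(r, θ, φ)`. -/
def polarMeasure : Measure (ℝ × ℝ × ℝ) :=
  (volume.restrict (Ioi 0)).prod
    ((volume.restrict (Ioc 0 Real.pi)).prod (volume.restrict (Ioc 0 (2 * Real.pi))))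

theorem polarMeasure_eq_restrict :
    polarMeasure = volume.restrict (Ioi 0 ×ˢ (Ioc 0 Real.pi ×ˢ Ioc 0 (2 * Real.pi))) := by
  rw [polarMeasure, Measure.prod_restrict, Measure.prod_restrict]
  rfl

/-- The density `r sin θ / 4π` of the fundamental solution of `-□`, a measure on the light cone,
with respect to Lebesgue measure in polar coordinates. It has no singularity: the kernel `1 / 4πr`
is multiplied by the Jacobian `r² sin θ`. -/
def lightWeight (s : ℝ × ℝ × ℝ) : ℝ := s.1 * Real.sin s.2.1 / (4 * Real.pi)

/-- The retarded (`ε = 1`) or advanced (`ε = -1`) solution `u` of `-□u = f`: the integral of `f`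
over the light cone with apex `p` that opens against the time direction `ε`. -/
def wavePotential (ε : ℝ) (f : Spacetime → ℝ) (p : Spacetime) : ℝ :=
  ∫ s, lightWeight s * f (p - lightVec ε s) ∂polarMeasure

theorem ae_polarMeasure : ∀ᵐ s ∂polarMeasure, 0 < s.1 ∧ 0 ≤ lightWeight s := by
  rw [polarMeasure_eq_restrict]
  filter_upwards [ae_restrict_mem (by measurability)] with s hs
  obtain ⟨h1, h2, -⟩ := hs
  have h1 : 0 < s.1 := h1
  refine ⟨h1, div_nonneg (mul_nonneg h1.le ?_) (by positivity)⟩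
  exact Real.sin_nonneg_of_nonneg_of_le_pi h2.1.le h2.2

@[fun_prop]
theorem continuous_lightVec : Continuous (lightVec ε) := by
  refine continuous_pi fun i => ?_
  fin_cases i <;> simp [lightVec] <;> fun_prop

@[fun_prop]
theorem continuous_lightWeight : Continuous lightWeight := by
  unfold lightWeight
  fun_prop

theorem lightVec_mem_cone (hε : ε ^ 2 = 1) (p : Spacetime) {s : ℝ × ℝ × ℝ} (hs : 0 < s.1) :
    p - lightVec ε s ∈ cone (-ε) p := by
  constructor
  · simp only [lightVec, Pi.sub_apply, Matrix.cons_val_zero]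
    nlinarith
  · simp only [lightVec, Pi.sub_apply, Matrix.cons_val_zero, Matrix.cons_val_one, Matrix.cons_val]
    apply le_of_eq
    linear_combination s.1 ^ 2 * Real.sin s.2.1 ^ 2 * Real.sin_sq_add_cos_sq s.2.2
      + s.1 ^ 2 * Real.sin_sq_add_cos_sq s.2.1 - s.1 ^ 2 * hε

theorem integral_sin_Ioc : ∫ θ in Ioc 0 Real.pi, Real.sin θ = 2 := by
  rw [← intervalIntegral.integral_of_le Real.pi_pos.le, integral_sin]
  norm_num

theorem lightWeight_mul_exp (lam : ℝ) (s : ℝ × ℝ × ℝ) :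
    lightWeight s * Real.exp (-(lam * s.1)) =
      (s.1 * Real.exp (-(lam * s.1))) * (Real.sin s.2.1 * (1 / (4 * Real.pi))) := by
  rw [lightWeight]
  ring

theorem integrable_lightWeight_mul_exp {lam : ℝ} (hlam : 0 < lam) :
    Integrable (fun s : ℝ × ℝ × ℝ => lightWeight s * Real.exp (-(lam * s.1))) polarMeasure := by
  simp_rw [lightWeight_mul_exp]
  refine Integrable.mul_prod (f := fun r : ℝ => r * Real.exp (-(lam * r)))
    (g := fun z : ℝ × ℝ => Real.sin z.1 * (1 / (4 * Real.pi))) ?_ ?_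
  · have := integrableOn_rpow_mul_exp_neg_mul_rpow (p := 1) (s := 1) (b := lam)
      (by norm_num) one_pos hlam
    simpa [IntegrableOn] using this
  · refine Integrable.mul_prod (f := Real.sin) (g := fun _ : ℝ => 1 / (4 * Real.pi)) ?_ ?_
    · exact (Real.continuous_sin.integrableOn_Icc).mono_set Ioc_subset_Icc_self
    · exact integrable_const _

theorem integral_lightWeight_mul_exp {lam : ℝ} (hlam : 0 < lam) :
    ∫ s, lightWeight s * Real.exp (-(lam * s.1)) ∂polarMeasure = 1 / lam ^ 2 := by
  simp_rw [lightWeight_mul_exp]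
  rw [polarMeasure, integral_prod_mul (fun r : ℝ => r * Real.exp (-(lam * r)))
    (fun z : ℝ × ℝ => Real.sin z.1 * (1 / (4 * Real.pi))),
    integral_prod_mul Real.sin (fun _ : ℝ => 1 / (4 * Real.pi)), integral_sin_Ioc]
  have h := Real.integral_rpow_mul_exp_neg_mul_Ioi (a := 2) (r := lam) two_pos hlam
  norm_num at h
  rw [h]
  simp
  have := Real.pi_pos.le
  rw [max_eq_left (by positivity)]
  have := Real.pi_pos
  field_simp
  norm_num

/-- The weighted bound `|f| ≤ C e^{λ ε t}`. It makes the integral over the unbounded light cone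
converge without any condition on the support. -/
def ExpBound (ε lam C : ℝ) (f : Spacetime → ℝ) : Prop :=
  ∀ x, |f x| ≤ C * Real.exp (lam * (ε * x 0))

theorem ExpBound.nonneg {lam C : ℝ} {f : Spacetime → ℝ} (h : ExpBound ε lam C f) : 0 ≤ C := by
  have := (abs_nonneg _).trans (h 0)
  simpa using this

theorem ExpBound.ae_le (hε : ε ^ 2 = 1) {lam C : ℝ} {f : Spacetime → ℝ} (h : ExpBound ε lam C f) :
    ∀ᵐ s ∂polarMeasure, ∀ p, |lightWeight s * f (p - lightVec ε s)|
      ≤ C * Real.exp (lam * (ε * p 0)) * (lightWeight s * Real.exp (-(lam * s.1))) := by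
  filter_upwards [ae_polarMeasure] with s hs p
  rw [abs_mul, abs_of_nonneg hs.2]
  have h1 := h (p - lightVec ε s)
  have e : lam * (ε * (p - lightVec ε s) 0) = lam * (ε * p 0) + -(lam * s.1) := by
    simp only [lightVec, Pi.sub_apply, Matrix.cons_val_zero]
    linear_combination (-lam * s.1) * hε
  rw [e, Real.exp_add] at h1
  calc _ ≤ lightWeight s * _ := mul_le_mul_of_nonneg_left h1 hs.2
    _ = _ := by ring

theorem ExpBound.integrable (hε : ε ^ 2 = 1) {lam C : ℝ} (hlam : 0 < lam) {f : Spacetime → ℝ}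
    (hf : Continuous f) (h : ExpBound ε lam C f) (p : Spacetime) :
    Integrable (fun s => lightWeight s * f (p - lightVec ε s)) polarMeasure := by
  refine Integrable.mono' ((integrable_lightWeight_mul_exp hlam).const_mul
    (C * Real.exp (lam * (ε * p 0)))) (by fun_prop) ?_
  filter_upwards [h.ae_le hε] with s hs using hs p

/-- The wave potential is a contraction for large `λ` in the norm `sup |f| e^{-λ ε t}`. -/
theorem ExpBound.contraction (hε : ε ^ 2 = 1) {lam C : ℝ} (hlam : 0 < lam) {f : Spacetime → ℝ}
    (h : ExpBound ε lam C f) : ExpBound ε lam (C / lam ^ 2) (wavePotential ε f) := by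
  intro p
  have h1 := norm_integral_le_of_norm_le (f := fun s => lightWeight s * f (p - lightVec ε s))
    ((integrable_lightWeight_mul_exp hlam).const_mul (C * Real.exp (lam * (ε * p 0))))
    ((h.ae_le hε).mono fun s hs => hs p)
  rw [integral_const_mul, integral_lightWeight_mul_exp hlam] at h1
  calc _ ≤ _ := h1
    _ = _ := by ring

theorem hasFDerivAt_wavePotential (hε : ε ^ 2 = 1) {lam C : ℝ} (hlam : 0 < lam)
    {f : Spacetime → ℝ} (hC : ExpBound ε lam C f) {g : Fin 4 → Spacetime → ℝ} {D : Fin 4 → ℝ}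
    (hg : ∀ i, Continuous (g i)) (hD : ∀ i, ExpBound ε lam (D i) (g i))
    (hfg : ∀ x, HasFDerivAt f (covector fun i => g i x) x) (p : Spacetime) :
    HasFDerivAt (wavePotential ε f) (covector fun i => wavePotential ε (g i) p) p := by
  have hfc : Continuous f := continuous_iff_continuousAt.2 fun x => (hfg x).continuousAt
  -- The weight is unbounded in time, so the dominating function is taken on a slab `ε t < const`.
  have hU : {x : Spacetime | lam * (ε * x 0) < lam * (ε * p 0) + 1} ∈ 𝓝 p :=
    IsOpen.mem_nhds (isOpen_lt (by fun_prop) (by fun_prop)) (by simp)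
  have h := hasFDerivAt_integral_of_dominated_of_fderiv_le (μ := polarMeasure) (𝕜 := ℝ)
    (F := fun x s => lightWeight s * f (x - lightVec ε s))
    (F' := fun x s => covector fun i => lightWeight s * g i (x - lightVec ε s))
    (bound := fun s => ∑ i, D i * Real.exp (lam * (ε * p 0) + 1) *
      (lightWeight s * Real.exp (-(lam * s.1)))) hU
    (Eventually.of_forall fun x => by fun_prop) (hC.integrable hε hlam hfc p)
    (by unfold covector; fun_prop) ?_ ?_ ?_
  · refine h.congr_fderiv ?_
    unfold covector
    rw [integral_finsetSum]
    · simp only [integral_smul_const]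
      rfl
    · intro i _
      exact ((hD i).integrable hε hlam (hg i) p).smul_const _
  · filter_upwards [ae_all_iff.2 fun i => (hD i).ae_le hε, ae_polarMeasure] with s hs hs0 x hx
    refine (norm_covector_le _).trans (Finset.sum_le_sum fun i _ => (hs i x).trans ?_)
    have := (hD i).nonneg
    have := hs0.2
    have hx' : lam * (ε * x 0) ≤ lam * (ε * p 0) + 1 := le_of_lt hx
    gcongr
  · exact integrable_finsetSum _ fun i _ => (integrable_lightWeight_mul_exp hlam).const_mul _
  · refine Eventually.of_forall fun s x _ => ?_
    have h1 : HasFDerivAt (fun y => f (y - lightVec ε s))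
        (covector fun i => g i (x - lightVec ε s)) x := (hasFDerivAt_comp_sub _).2 (hfg _)
    refine (h1.const_mul (lightWeight s)).congr_fderiv ?_
    simp only [covector, Finset.smul_sum, smul_smul]

theorem wavePotential_add (hε : ε ^ 2 = 1) {lam C D : ℝ} (hlam : 0 < lam)
    {f g : Spacetime → ℝ} (hf : Continuous f) (hg : Continuous g) (hC : ExpBound ε lam C f)
    (hD : ExpBound ε lam D g) :
    wavePotential ε (f + g) = wavePotential ε f + wavePotential ε g := by
  funext p
  simp only [wavePotential, Pi.add_apply, mul_add]
  exact integral_add (hC.integrable hε hlam hf p) (hD.integrable hε hlam hg p)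

theorem wavePotential_smul (c : ℝ) (f : Spacetime → ℝ) :
    wavePotential ε (c • f) = c • wavePotential ε f := by
  funext p
  simp only [wavePotential, Pi.smul_apply, smul_eq_mul, ← integral_const_mul]
  congr 1
  funext s
  ring

theorem wavePotential_congr (hε : ε ^ 2 = 1) {f g : Spacetime → ℝ} {p : Spacetime}
    (h : EqOn f g (cone (-ε) p)) : wavePotential ε f p = wavePotential ε g p := by
  refine integral_congr_ae ?_
  filter_upwards [ae_polarMeasure] with s hs
  simp only [h (lightVec_mem_cone hε p hs.1)]

/-! ### The wave potential inverts the wave operator -/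

/-- The space of test functions. -/
def TestFunction : Submodule ℝ (Spacetime → ℝ) where
  carrier := {f | ContDiff ℝ ∞ f ∧ HasCompactSupport f}
  add_mem' hf hg := ⟨hf.1.add hg.1, hf.2.add hg.2⟩
  zero_mem' := ⟨contDiff_const, HasCompactSupport.zero⟩
  smul_mem' c _ hf := ⟨hf.1.const_smul c, hf.2.mono (Function.support_const_smul_subset c _)⟩

theorem partialDeriv_mem_testFunction {f : Spacetime → ℝ} (hf : f ∈ TestFunction) (i : Fin 4) :
    partialDeriv i f ∈ TestFunction :=
  ⟨contDiff_partialDeriv i hf.1, hf.2.mono' ((subset_tsupport _).trans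
    (tsupport_partialDeriv_subset i f))⟩

theorem kleinGordonFun_mem_testFunction (m : ℝ) {f : Spacetime → ℝ} (hf : f ∈ TestFunction) :
    kleinGordonFun m f ∈ TestFunction :=
  ⟨contDiff_kleinGordonFun m hf.1, hf.2.mono' ((subset_tsupport _).trans
    (tsupport_kleinGordonFun_subset m f))⟩

theorem hasDerivAt_comp_path {g : Spacetime → ℝ} (hg : ContDiff ℝ ∞ g) {c : ℝ → Spacetime}
    {c' : Spacetime} {t : ℝ} (hc : HasDerivAt c c' t) :
    HasDerivAt (fun u => g (c u)) (partialDeriv 0 g (c t) * c' 0 + partialDeriv 1 g (c t) * c' 1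
      + partialDeriv 2 g (c t) * c' 2 + partialDeriv 3 g (c t) * c' 3) t := by
  have h := (hasFDerivAt_covector (differentiable_of_contDiff hg (c t))).comp_hasDerivAt t hc
  rwa [covector_apply, Fin.sum_univ_four] at h

theorem hasDerivAt_path_radius (p : Spacetime) (r θ φ : ℝ) :
    HasDerivAt (fun u => p - lightVec ε (u, θ, φ))
      ![-ε, -(Real.sin θ * Real.cos φ), -(Real.sin θ * Real.sin φ), -Real.cos θ] r := by
  rw [hasDerivAt_pi]
  have h := hasDerivAt_id' r
  intro i
  fin_cases i
  · simpa [lightVec] using (h.const_mul ε).const_sub (p 0)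
  · simpa [lightVec] using (h.mul_const (Real.sin θ * Real.cos φ)).const_sub (p 1)
  · simpa [lightVec] using (h.mul_const (Real.sin θ * Real.sin φ)).const_sub (p 2)
  · simpa [lightVec] using (h.mul_const (Real.cos θ)).const_sub (p 3)

theorem hasDerivAt_path_polar (p : Spacetime) (r θ φ : ℝ) :
    HasDerivAt (fun u => p - lightVec ε (r, u, φ))
      ![0, -(r * (Real.cos θ * Real.cos φ)), -(r * (Real.cos θ * Real.sin φ)), r * Real.sin θ]
      θ := by
  rw [hasDerivAt_pi]
  have hs := Real.hasDerivAt_sin θ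
  have hc := Real.hasDerivAt_cos θ
  intro i
  fin_cases i
  · simpa [lightVec] using hasDerivAt_const θ (p 0 - ε * r)
  · simpa [lightVec] using ((hs.mul_const (Real.cos φ)).const_mul r).const_sub (p 1)
  · simpa [lightVec] using ((hs.mul_const (Real.sin φ)).const_mul r).const_sub (p 2)
  · simpa [lightVec] using (hc.const_mul r).const_sub (p 3)

theorem hasDerivAt_path_azimuth (p : Spacetime) (r θ φ : ℝ) :
    HasDerivAt (fun u => p - lightVec ε (r, θ, u))
      ![0, r * (Real.sin θ * Real.sin φ), -(r * (Real.sin θ * Real.cos φ)), 0] φ := by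
  rw [hasDerivAt_pi]
  have hs := Real.hasDerivAt_sin φ
  have hc := Real.hasDerivAt_cos φ
  intro i
  fin_cases i
  · simpa [lightVec] using hasDerivAt_const φ (p 0 - ε * r)
  · simpa [lightVec] using ((hc.const_mul (Real.sin θ)).const_mul r).const_sub (p 1)
  · simpa [lightVec] using ((hs.const_mul (Real.sin θ)).const_mul r).const_sub (p 2)
  · simpa [lightVec] using hasDerivAt_const φ (p 3 - r * Real.cos θ)

/-- The radial flux `f - r (∂_ω f - ε ∂ₜ f)` on the light cone. -/
def radialFlux (ε : ℝ) (f : Spacetime → ℝ) (p : Spacetime) (s : ℝ × ℝ × ℝ) : ℝ :=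
  f (p - lightVec ε s) + s.1 * (ε * partialDeriv 0 f (p - lightVec ε s)
    - Real.sin s.2.1 * Real.cos s.2.2 * partialDeriv 1 f (p - lightVec ε s)
    - Real.sin s.2.1 * Real.sin s.2.2 * partialDeriv 2 f (p - lightVec ε s)
    - Real.cos s.2.1 * partialDeriv 3 f (p - lightVec ε s))

/-- The `r`-derivative of `radialFlux`. -/
def radialDiv (ε : ℝ) (f : Spacetime → ℝ) (p : Spacetime) (s : ℝ × ℝ × ℝ) : ℝ :=
  -2 * (Real.sin s.2.1 * Real.cos s.2.2 * partialDeriv 1 f (p - lightVec ε s)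
    + Real.sin s.2.1 * Real.sin s.2.2 * partialDeriv 2 f (p - lightVec ε s)
    + Real.cos s.2.1 * partialDeriv 3 f (p - lightVec ε s))
  + s.1 * (-partialDeriv 0 (partialDeriv 0 f) (p - lightVec ε s)
    + (Real.sin s.2.1 * Real.cos s.2.2) ^ 2 * partialDeriv 1 (partialDeriv 1 f) (p - lightVec ε s)
    + (Real.sin s.2.1 * Real.sin s.2.2) ^ 2 * partialDeriv 2 (partialDeriv 2 f) (p - lightVec ε s)
    + Real.cos s.2.1 ^ 2 * partialDeriv 3 (partialDeriv 3 f) (p - lightVec ε s)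
    + 2 * (Real.sin s.2.1 ^ 2 * Real.sin s.2.2 * Real.cos s.2.2
        * partialDeriv 1 (partialDeriv 2 f) (p - lightVec ε s)
      + Real.sin s.2.1 * Real.cos s.2.1 * Real.cos s.2.2
        * partialDeriv 1 (partialDeriv 3 f) (p - lightVec ε s)
      + Real.sin s.2.1 * Real.cos s.2.1 * Real.sin s.2.2
        * partialDeriv 2 (partialDeriv 3 f) (p - lightVec ε s)))

/-- The flux `-sin θ ∂_{e_θ} f` in the direction of `θ`. -/
def polarFlux (ε : ℝ) (f : Spacetime → ℝ) (p : Spacetime) (s : ℝ × ℝ × ℝ) : ℝ :=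
  Real.sin s.2.1 * (Real.sin s.2.1 * partialDeriv 3 f (p - lightVec ε s)
    - Real.cos s.2.1 * Real.cos s.2.2 * partialDeriv 1 f (p - lightVec ε s)
    - Real.cos s.2.1 * Real.sin s.2.2 * partialDeriv 2 f (p - lightVec ε s))

/-- The `θ`-derivative of `polarFlux`. -/
def polarDiv (ε : ℝ) (f : Spacetime → ℝ) (p : Spacetime) (s : ℝ × ℝ × ℝ) : ℝ :=
  Real.cos s.2.1 * (Real.sin s.2.1 * partialDeriv 3 f (p - lightVec ε s)
    - Real.cos s.2.1 * Real.cos s.2.2 * partialDeriv 1 f (p - lightVec ε s)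
    - Real.cos s.2.1 * Real.sin s.2.2 * partialDeriv 2 f (p - lightVec ε s))
  + Real.sin s.2.1 * (Real.cos s.2.1 * partialDeriv 3 f (p - lightVec ε s)
    + Real.sin s.2.1 * Real.cos s.2.2 * partialDeriv 1 f (p - lightVec ε s)
    + Real.sin s.2.1 * Real.sin s.2.2 * partialDeriv 2 f (p - lightVec ε s))
  + s.1 * Real.sin s.2.1 * (
    (Real.cos s.2.1 * Real.cos s.2.2) ^ 2 * partialDeriv 1 (partialDeriv 1 f) (p - lightVec ε s)
    + (Real.cos s.2.1 * Real.sin s.2.2) ^ 2 * partialDeriv 2 (partialDeriv 2 f) (p - lightVec ε s)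
    + Real.sin s.2.1 ^ 2 * partialDeriv 3 (partialDeriv 3 f) (p - lightVec ε s)
    + 2 * (Real.cos s.2.1 ^ 2 * Real.sin s.2.2 * Real.cos s.2.2
        * partialDeriv 1 (partialDeriv 2 f) (p - lightVec ε s)
      - Real.sin s.2.1 * Real.cos s.2.1 * Real.cos s.2.2
        * partialDeriv 1 (partialDeriv 3 f) (p - lightVec ε s)
      - Real.sin s.2.1 * Real.cos s.2.1 * Real.sin s.2.2
        * partialDeriv 2 (partialDeriv 3 f) (p - lightVec ε s)))

/-- The flux `-∂_{e_φ} f` in the direction of `φ`. -/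
def azimuthFlux (ε : ℝ) (f : Spacetime → ℝ) (p : Spacetime) (s : ℝ × ℝ × ℝ) : ℝ :=
  Real.sin s.2.2 * partialDeriv 1 f (p - lightVec ε s)
    - Real.cos s.2.2 * partialDeriv 2 f (p - lightVec ε s)

/-- The `φ`-derivative of `azimuthFlux`. -/
def azimuthDiv (ε : ℝ) (f : Spacetime → ℝ) (p : Spacetime) (s : ℝ × ℝ × ℝ) : ℝ :=
  Real.cos s.2.2 * partialDeriv 1 f (p - lightVec ε s)
    + Real.sin s.2.2 * partialDeriv 2 f (p - lightVec ε s)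
    + s.1 * Real.sin s.2.1 * (
      Real.sin s.2.2 ^ 2 * partialDeriv 1 (partialDeriv 1 f) (p - lightVec ε s)
      + Real.cos s.2.2 ^ 2 * partialDeriv 2 (partialDeriv 2 f) (p - lightVec ε s)
      - 2 * Real.sin s.2.2 * Real.cos s.2.2
        * partialDeriv 1 (partialDeriv 2 f) (p - lightVec ε s))

theorem hasDerivAt_radialFlux (hε : ε ^ 2 = 1) {f : Spacetime → ℝ} (hf : ContDiff ℝ ∞ f)
    (p : Spacetime) (r θ φ : ℝ) :
    HasDerivAt (fun u => radialFlux ε f p (u, θ, φ)) (radialDiv ε f p (r, θ, φ)) r := by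
  have hc := hasDerivAt_path_radius (ε := ε) p r θ φ
  have h := hasDerivAt_comp_path hf hc
  have hd := fun i => hasDerivAt_comp_path (contDiff_partialDeriv i hf) hc
  have key := h.add ((hasDerivAt_id' r).mul (((((hd 0).const_mul ε).sub
    ((hd 1).const_mul (Real.sin θ * Real.cos φ))).sub
    ((hd 2).const_mul (Real.sin θ * Real.sin φ))).sub ((hd 3).const_mul (Real.cos θ))))
  refine key.congr_deriv ?_
  simp only [radialDiv, Matrix.cons_val_zero, Matrix.cons_val_one, Matrix.cons_val, Pi.sub_apply]
  rw [partialDeriv_comm hf 1 0, partialDeriv_comm hf 2 0, partialDeriv_comm hf 3 0,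
    partialDeriv_comm hf 2 1, partialDeriv_comm hf 3 1, partialDeriv_comm hf 3 2]
  linear_combination -r * partialDeriv 0 (partialDeriv 0 f) (p - lightVec ε (r, θ, φ)) * hε

theorem hasDerivAt_polarFlux {f : Spacetime → ℝ} (hf : ContDiff ℝ ∞ f)
    (p : Spacetime) (r θ φ : ℝ) :
    HasDerivAt (fun u => polarFlux ε f p (r, u, φ)) (polarDiv ε f p (r, θ, φ)) θ := by
  have hc := hasDerivAt_path_polar (ε := ε) p r θ φ
  have hd := fun i => hasDerivAt_comp_path (contDiff_partialDeriv i hf) hc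
  have hsin := Real.hasDerivAt_sin θ
  have hcos := Real.hasDerivAt_cos θ
  have key := hsin.mul (((hsin.mul (hd 3)).sub ((hcos.mul_const (Real.cos φ)).mul (hd 1))).sub
    ((hcos.mul_const (Real.sin φ)).mul (hd 2)))
  refine key.congr_deriv ?_
  simp only [polarDiv, Matrix.cons_val_zero, Matrix.cons_val_one, Matrix.cons_val, Pi.mul_apply,
    Pi.sub_apply]
  rw [partialDeriv_comm hf 2 1, partialDeriv_comm hf 3 1, partialDeriv_comm hf 3 2]
  ring

theorem hasDerivAt_azimuthFlux {f : Spacetime → ℝ} (hf : ContDiff ℝ ∞ f)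
    (p : Spacetime) (r θ φ : ℝ) :
    HasDerivAt (fun u => azimuthFlux ε f p (r, θ, u)) (azimuthDiv ε f p (r, θ, φ)) φ := by
  have hc := hasDerivAt_path_azimuth (ε := ε) p r θ φ
  have hd := fun i => hasDerivAt_comp_path (contDiff_partialDeriv i hf) hc
  have key := ((Real.hasDerivAt_sin φ).mul (hd 1)).sub ((Real.hasDerivAt_cos φ).mul (hd 2))
  refine key.congr_deriv ?_
  simp only [azimuthDiv, Matrix.cons_val_zero, Matrix.cons_val_one, Matrix.cons_val]
  rw [partialDeriv_comm hf 2 1]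
  ring

/-- In polar coordinates on the light cone, `r sin θ □f` is a divergence. -/
theorem lightWeight_mul_wave_eq (f : Spacetime → ℝ) (p : Spacetime)
    (s : ℝ × ℝ × ℝ) :
    lightWeight s * kleinGordonFun 0 f (p - lightVec ε s) = 1 / (4 * Real.pi) *
      (Real.sin s.2.1 * radialDiv ε f p s + polarDiv ε f p s + azimuthDiv ε f p s) := by
  have h1 := Real.sin_sq_add_cos_sq s.2.1
  have h2 := Real.sin_sq_add_cos_sq s.2.2
  simp only [lightWeight, radialDiv, polarDiv, azimuthDiv, kleinGordonFun]
  generalize partialDeriv 1 (partialDeriv 2 f) (p - lightVec ε s) = d12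
  generalize partialDeriv 1 (partialDeriv 3 f) (p - lightVec ε s) = d13
  generalize partialDeriv 2 (partialDeriv 3 f) (p - lightVec ε s) = d23
  generalize partialDeriv 0 (partialDeriv 0 f) (p - lightVec ε s) = d00
  generalize partialDeriv 1 (partialDeriv 1 f) (p - lightVec ε s) = d11
  generalize partialDeriv 2 (partialDeriv 2 f) (p - lightVec ε s) = d22
  generalize partialDeriv 3 (partialDeriv 3 f) (p - lightVec ε s) = d33
  generalize partialDeriv 1 f (p - lightVec ε s) = d1
  generalize partialDeriv 2 f (p - lightVec ε s) = d2
  generalize partialDeriv 3 f (p - lightVec ε s) = d3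
  have hS : Real.sin s.2.1 ^ 2 = 1 - Real.cos s.2.1 ^ 2 := by linarith
  have hT : Real.sin s.2.2 ^ 2 = 1 - Real.cos s.2.2 ^ 2 := by linarith
  generalize Real.sin s.2.1 = S at *
  generalize Real.cos s.2.1 = c at *
  generalize Real.sin s.2.2 = T at *
  generalize Real.cos s.2.2 = k at *
  have key : s.1 * S * (-d00 + d11 + d22 + d33 - 0 ^ 2 * f (p - lightVec ε s)) =
      S * (-2 * (S * k * d1 + S * T * d2 + c * d3)
        + s.1 * (-d00 + (S * k) ^ 2 * d11 + (S * T) ^ 2 * d22 + c ^ 2 * d33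
          + 2 * (S ^ 2 * T * k * d12 + S * c * k * d13 + S * c * T * d23)))
      + (c * (S * d3 - c * k * d1 - c * T * d2) + S * (c * d3 + S * k * d1 + S * T * d2)
        + s.1 * S * ((c * k) ^ 2 * d11 + (c * T) ^ 2 * d22 + S ^ 2 * d33
          + 2 * (c ^ 2 * T * k * d12 - S * c * k * d13 - S * c * T * d23)))
      + (k * d1 + T * d2
        + s.1 * S * (T ^ 2 * d11 + k ^ 2 * d22 - 2 * T * k * d12)) := by
    simp only [mul_pow, hT]
    ring_nf
    have hS3 : S ^ 3 = S * (1 - c ^ 2) := by rw [← hS]; ring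
    simp only [hS3, hS]
    ring
  linear_combination (1 / (4 * Real.pi)) * key

theorem integrable_polarMeasure_of_continuous {h : ℝ × ℝ × ℝ → ℝ} (hc : Continuous h) {R : ℝ}
    (hR : ∀ s, R < s.1 → h s = 0) : Integrable h polarMeasure := by
  rw [polarMeasure_eq_restrict]
  have h1 : IntegrableOn h (Icc 0 R ×ˢ (Icc 0 Real.pi ×ˢ Icc 0 (2 * Real.pi))) :=
    hc.continuousOn.integrableOn_compact
      (isCompact_Icc.prod (isCompact_Icc.prod isCompact_Icc))
  refine h1.of_forall_sdiff_eq_zero (by measurability) fun s hs => ?_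
  refine hR s (not_le.1 fun hle => hs.2 ?_)
  obtain ⟨⟨h1, h2, h3⟩, -⟩ := hs
  exact ⟨⟨le_of_lt h1, hle⟩, Ioc_subset_Icc_self h2, Ioc_subset_Icc_self h3⟩

theorem exists_forall_lightVec_notMem {K : Set Spacetime} (hε : ε ^ 2 = 1) (hK : IsCompact K)
    (p : Spacetime) : ∃ R, ∀ s : ℝ × ℝ × ℝ, R < s.1 → p - lightVec ε s ∉ K := by
  obtain ⟨M, hM⟩ := hK.isBounded.exists_norm_le
  refine ⟨M + |p 0|, fun s hs hsK => ?_⟩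
  have h1 := (norm_le_pi_norm (p - lightVec ε s) 0).trans (hM _ hsK)
  rw [Real.norm_eq_abs] at h1
  have h2 : |(lightVec ε s) 0| = |s.1| := by
    have : |ε| = 1 := by rw [← sq_eq_sq₀ (abs_nonneg _) zero_le_one, sq_abs, hε, one_pow]
    simp [lightVec, abs_mul, this]
  have h3 := abs_sub_abs_le_abs_sub (lightVec ε s 0) (p 0)
  rw [abs_sub_comm, h2] at h3
  have h4 := le_abs_self s.1
  have : |(p - lightVec ε s) 0| = |p 0 - lightVec ε s 0| := rfl
  linarith

theorem integrableOn_prod_of_continuous {h : ℝ × ℝ → ℝ} (hc : Continuous h) :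
    Integrable h ((volume.restrict (Ioc 0 Real.pi)).prod
      (volume.restrict (Ioc 0 (2 * Real.pi)))) := by
  rw [Measure.prod_restrict]
  have h1 : IntegrableOn h (Icc 0 Real.pi ×ˢ Icc 0 (2 * Real.pi)) :=
    hc.continuousOn.integrableOn_compact (isCompact_Icc.prod isCompact_Icc)
  exact h1.mono_set (prod_mono Ioc_subset_Icc_self Ioc_subset_Icc_self)

/-- Kirchhoff's formula: of the three fluxes only the radial one has a boundary contribution, which
is `f p` at the apex `r = 0`; `polarFlux` vanishes at `θ = 0, π` and `azimuthFlux` is periodic. -/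
theorem wavePotential_wave (hε : ε ^ 2 = 1) {f : Spacetime → ℝ} (hf : f ∈ TestFunction) :
    wavePotential ε (kleinGordonFun 0 f) = -f := by
  funext p
  have hc0 : Continuous f := hf.1.continuous
  have hc1 : ∀ i, Continuous (partialDeriv i f) := fun i =>
    (contDiff_partialDeriv i hf.1).continuous
  have hc2 : ∀ i j, Continuous (partialDeriv i (partialDeriv j f)) := fun i j =>
    (contDiff_partialDeriv i (contDiff_partialDeriv j hf.1)).continuous
  obtain ⟨R, hR⟩ := exists_forall_lightVec_notMem hε hf.2 p
  have hz0 : ∀ s : ℝ × ℝ × ℝ, R < s.1 → f (p - lightVec ε s) = 0 := fun s hs =>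
    image_eq_zero_of_notMem_tsupport (hR s hs)
  have hz1 : ∀ i, ∀ s : ℝ × ℝ × ℝ, R < s.1 → partialDeriv i f (p - lightVec ε s) = 0 :=
    fun i s hs => image_eq_zero_of_notMem_tsupport fun h =>
      hR s hs (tsupport_partialDeriv_subset i f h)
  have hz2 : ∀ i j, ∀ s : ℝ × ℝ × ℝ, R < s.1 →
      partialDeriv i (partialDeriv j f) (p - lightVec ε s) = 0 :=
    fun i j s hs => image_eq_zero_of_notMem_tsupport fun h =>
      hR s hs (tsupport_partialDeriv_subset j f (tsupport_partialDeriv_subset i _ h))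
  have cr : Continuous (radialDiv ε f p) := by unfold radialDiv; fun_prop
  have cp : Continuous (polarDiv ε f p) := by unfold polarDiv; fun_prop
  have ca : Continuous (azimuthDiv ε f p) := by unfold azimuthDiv; fun_prop
  have zr : ∀ s, R < s.1 → radialDiv ε f p s = 0 := fun s hs => by
    simp [radialDiv, hz1 _ s hs, hz2 _ _ s hs]
  have zp : ∀ s, R < s.1 → polarDiv ε f p s = 0 := fun s hs => by
    simp [polarDiv, hz1 _ s hs, hz2 _ _ s hs]
  have za : ∀ s, R < s.1 → azimuthDiv ε f p s = 0 := fun s hs => by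
    simp [azimuthDiv, hz1 _ s hs, hz2 _ _ s hs]
  have ir : Integrable (fun s => Real.sin s.2.1 * radialDiv ε f p s) polarMeasure :=
    integrable_polarMeasure_of_continuous (by fun_prop) fun s hs => by rw [zr s hs, mul_zero]
  have ip : Integrable (polarDiv ε f p) polarMeasure := integrable_polarMeasure_of_continuous cp zp
  have ia : Integrable (azimuthDiv ε f p) polarMeasure :=
    integrable_polarMeasure_of_continuous ca za
  have eqr : ∫ s, Real.sin s.2.1 * radialDiv ε f p s ∂polarMeasure = -(4 * Real.pi * f p) := by
    have inner : ∀ z : ℝ × ℝ, ∫ r in Ioi 0, Real.sin z.1 * radialDiv ε f p (r, z)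
        = Real.sin z.1 * (-f p) := fun z => by
      rw [integral_const_mul]
      congr 1
      have hlim : Tendsto (fun r => radialFlux ε f p (r, z)) atTop (𝓝 0) := by
        refine tendsto_const_nhds.congr' ?_
        filter_upwards [eventually_gt_atTop R] with r hr
        simp [radialFlux, hz0 (r, z) hr, hz1 _ (r, z) hr]
      have hint : IntegrableOn (fun r => radialDiv ε f p (r, z)) (Ioi 0) := by
        have h1 : IntegrableOn (fun r => radialDiv ε f p (r, z)) (Icc 0 R) :=
          (cr.comp (by fun_prop : Continuous fun r : ℝ => (r, z))).integrableOn_Icc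
        exact h1.of_forall_sdiff_eq_zero measurableSet_Ioi fun r hr =>
          zr (r, z) (not_le.1 fun hle => hr.2 ⟨le_of_lt hr.1, hle⟩)
      rw [integral_Ioi_of_hasDerivAt_of_tendsto
        (hasDerivAt_radialFlux hε hf.1 p 0 z.1 z.2).continuousAt.continuousWithinAt
        (fun r _ => hasDerivAt_radialFlux hε hf.1 p r z.1 z.2) hint hlim]
      have : lightVec ε (0, z.1, z.2) = 0 := by
        funext i
        fin_cases i <;> simp [lightVec]
      simp [radialFlux, this]
    rw [polarMeasure, integral_prod_symm _ ir]
    simp_rw [inner]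
    rw [integral_prod_mul Real.sin (fun _ : ℝ => -f p), integral_sin_Ioc]
    have := Real.pi_pos.le
    simp
    rw [max_eq_left (by positivity)]
    ring
  have eqp : ∫ s, polarDiv ε f p s ∂polarMeasure = 0 := by
    rw [polarMeasure, integral_prod _ ip]
    refine integral_eq_zero_of_ae (Eventually.of_forall fun r => ?_)
    have hcr : Continuous fun z : ℝ × ℝ => polarDiv ε f p (r, z) := cp.comp (by fun_prop)
    simp only [Pi.zero_apply]
    rw [integral_prod_symm _ (integrableOn_prod_of_continuous hcr)]
    refine integral_eq_zero_of_ae (Eventually.of_forall fun φ => ?_)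
    simp only [Pi.zero_apply]
    rw [← intervalIntegral.integral_of_le Real.pi_pos.le,
      intervalIntegral.integral_eq_sub_of_hasDerivAt
        (fun θ _ => hasDerivAt_polarFlux hf.1 p r θ φ)
        ((cp.comp (by fun_prop : Continuous fun θ : ℝ => (r, θ, φ))).intervalIntegrable _ _)]
    simp [polarFlux]
  have eqa : ∫ s, azimuthDiv ε f p s ∂polarMeasure = 0 := by
    rw [polarMeasure, integral_prod _ ia]
    refine integral_eq_zero_of_ae (Eventually.of_forall fun r => ?_)
    have hcr : Continuous fun z : ℝ × ℝ => azimuthDiv ε f p (r, z) := ca.comp (by fun_prop)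
    simp only [Pi.zero_apply]
    rw [integral_prod _ (integrableOn_prod_of_continuous hcr)]
    refine integral_eq_zero_of_ae (Eventually.of_forall fun θ => ?_)
    simp only [Pi.zero_apply]
    rw [← intervalIntegral.integral_of_le Real.two_pi_pos.le,
      intervalIntegral.integral_eq_sub_of_hasDerivAt
        (fun φ _ => hasDerivAt_azimuthFlux hf.1 p r θ φ)
        ((ca.comp (by fun_prop : Continuous fun φ : ℝ => (r, θ, φ))).intervalIntegrable _ _)]
    simp [azimuthFlux, lightVec]
  have e : wavePotential ε (kleinGordonFun 0 f) p = 1 / (4 * Real.pi) *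
      ∫ s, (Real.sin s.2.1 * radialDiv ε f p s + polarDiv ε f p s + azimuthDiv ε f p s)
        ∂polarMeasure := by
    rw [← integral_const_mul]
    exact integral_congr_ae (Eventually.of_forall fun s => lightWeight_mul_wave_eq f p s)
  have e2 := integral_add (ir.add ip) ia
  have e3 := integral_add ir ip
  simp only [Pi.add_apply] at e2
  rw [e, e2, e3, eqr, eqp, eqa, Pi.neg_apply]
  have := Real.pi_pos
  field_simp
  ring

/-! ### The Klein-Gordon potential of a test function -/

theorem TestFunction.exists_expBound (ε lam : ℝ) {f : Spacetime → ℝ} (hf : f ∈ TestFunction) :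
    ∃ C, ExpBound ε lam C f := by
  have hc : HasCompactSupport fun x : Spacetime => f x * Real.exp (-(lam * (ε * x 0))) :=
    hf.2.mul_right
  obtain ⟨C, hC⟩ := hc.exists_bound_of_continuous (hf.1.continuous.mul (by fun_prop))
  refine ⟨C, fun x => ?_⟩
  have h := hC x
  rw [Real.norm_eq_abs, abs_mul, Real.abs_exp, Real.exp_neg, ← div_eq_mul_inv,
    div_le_iff₀ (Real.exp_pos _)] at h
  exact h

theorem ExpBound.iterate (hε : ε ^ 2 = 1) {lam C : ℝ} (hlam : 0 < lam) {f : Spacetime → ℝ}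
    (h : ExpBound ε lam C f) (k : ℕ) :
    ExpBound ε lam (C * (1 / lam ^ 2) ^ k) ((wavePotential ε)^[k] f) := by
  induction k with
  | zero => simpa using h
  | succ k ih =>
    rw [Function.iterate_succ', Function.comp_apply]
    convert ih.contraction hε hlam using 1
    ring

theorem TestFunction.hasFDerivAt_iterate (hε : ε ^ 2 = 1) (k : ℕ) {f : Spacetime → ℝ}
    (hf : f ∈ TestFunction) (x : Spacetime) :
    HasFDerivAt ((wavePotential ε)^[k] f)
      (covector fun i => (wavePotential ε)^[k] (partialDeriv i f) x) x := by
  induction k generalizing f x with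
  | zero => exact hasFDerivAt_covector (differentiable_of_contDiff hf.1 x)
  | succ k ih =>
    simp only [Function.iterate_succ', Function.comp_apply]
    obtain ⟨C, hC⟩ := TestFunction.exists_expBound ε 1 hf
    choose D hD using fun i =>
      TestFunction.exists_expBound ε 1 (partialDeriv_mem_testFunction hf i)
    exact hasFDerivAt_wavePotential hε one_pos (hC.iterate hε one_pos k)
      (g := fun i => (wavePotential ε)^[k] (partialDeriv i f))
      (fun i => continuous_iff_continuousAt.2 fun y =>
        (ih (partialDeriv_mem_testFunction hf i) y).continuousAt)
      (fun i => (hD i).iterate hε one_pos k) (fun y => ih hf y) x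

theorem TestFunction.iterate_add (hε : ε ^ 2 = 1) (k : ℕ) {f g : Spacetime → ℝ}
    (hf : f ∈ TestFunction) (hg : g ∈ TestFunction) :
    (wavePotential ε)^[k] (f + g) = (wavePotential ε)^[k] f + (wavePotential ε)^[k] g := by
  induction k with
  | zero => rfl
  | succ k ih =>
    simp only [Function.iterate_succ', Function.comp_apply]
    obtain ⟨C, hC⟩ := TestFunction.exists_expBound ε 1 hf
    obtain ⟨D, hD⟩ := TestFunction.exists_expBound ε 1 hg
    rw [ih]
    exact wavePotential_add hε one_pos
      (continuous_iff_continuousAt.2 fun y => (hasFDerivAt_iterate hε k hf y).continuousAt)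
      (continuous_iff_continuousAt.2 fun y => (hasFDerivAt_iterate hε k hg y).continuousAt)
      (hC.iterate hε one_pos k) (hD.iterate hε one_pos k)

theorem iterate_smul (k : ℕ) (c : ℝ) (f : Spacetime → ℝ) :
    (wavePotential ε)^[k] (c • f) = c • (wavePotential ε)^[k] f := by
  induction k with
  | zero => rfl
  | succ k ih => simp only [Function.iterate_succ', Function.comp_apply, ih, wavePotential_smul]

/-- The retarded (`ε = 1`) or advanced (`ε = -1`) solution `u` of `P u = f`, as the Neumann series
`-∑ₖ (-m²)ᵏ Kᵏ⁺¹ f` in powers of the wave potential `K = -□⁻¹`. -/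
def potential (ε m : ℝ) (f : Spacetime → ℝ) (x : Spacetime) : ℝ :=
  -∑' k : ℕ, (-m ^ 2) ^ k * (wavePotential ε)^[k + 1] f x

/-- The terms of the Neumann series decay geometrically: in the norm with `λ = |m| + 1` the wave
potential has norm `λ⁻² < m⁻²`. -/
theorem ExpBound.term_le (hε : ε ^ 2 = 1) (m : ℝ) {C : ℝ} {f : Spacetime → ℝ}
    (h : ExpBound ε (|m| + 1) C f) (k : ℕ) (x : Spacetime) :
    |(-m ^ 2) ^ k * (wavePotential ε)^[k] f x|
      ≤ C * Real.exp ((|m| + 1) * (ε * x 0)) * (m ^ 2 / (|m| + 1) ^ 2) ^ k := by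
  have hlam : 0 < |m| + 1 := by positivity
  rw [abs_mul, abs_pow, abs_neg, abs_of_nonneg (sq_nonneg m)]
  refine (mul_le_mul_of_nonneg_left (h.iterate hε hlam k x) (by positivity)).trans (le_of_eq ?_)
  rw [div_pow, div_pow, one_pow]
  ring

theorem summable_ratio (m : ℝ) : Summable fun k : ℕ => (m ^ 2 / (|m| + 1) ^ 2) ^ k := by
  refine summable_geometric_of_lt_one (by positivity) ?_
  rw [div_lt_one (by positivity), ← sq_abs]
  exact pow_lt_pow_left₀ (by linarith) (abs_nonneg m) two_ne_zero

theorem ExpBound.summable (hε : ε ^ 2 = 1) (m : ℝ) {C : ℝ} {f : Spacetime → ℝ}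
    (h : ExpBound ε (|m| + 1) C f) (x : Spacetime) :
    Summable fun k : ℕ => (-m ^ 2) ^ k * (wavePotential ε)^[k] f x :=
  Summable.of_norm_bounded ((summable_ratio m).mul_left _) fun k => h.term_le hε m k x

theorem TestFunction.exists_expBound_wavePotential (hε : ε ^ 2 = 1) (m : ℝ) {f : Spacetime → ℝ}
    (hf : f ∈ TestFunction) : ∃ C, ExpBound ε (|m| + 1) C (wavePotential ε f) := by
  obtain ⟨C, hC⟩ := TestFunction.exists_expBound ε (|m| + 1) hf
  exact ⟨_, hC.contraction hε (by positivity)⟩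

theorem TestFunction.summable (hε : ε ^ 2 = 1) (m : ℝ) {f : Spacetime → ℝ}
    (hf : f ∈ TestFunction) (x : Spacetime) :
    Summable fun k : ℕ => (-m ^ 2) ^ k * (wavePotential ε)^[k + 1] f x := by
  obtain ⟨C, hC⟩ := TestFunction.exists_expBound_wavePotential hε m hf
  exact hC.summable hε m x

theorem TestFunction.potential_add (hε : ε ^ 2 = 1) (m : ℝ) {f g : Spacetime → ℝ}
    (hf : f ∈ TestFunction) (hg : g ∈ TestFunction) :
    potential ε m (f + g) = potential ε m f + potential ε m g := by
  funext x
  simp only [potential, Pi.add_apply]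
  rw [← neg_add, ← (TestFunction.summable hε m hf x).tsum_add (TestFunction.summable hε m hg x)]
  congr 2
  funext k
  rw [TestFunction.iterate_add hε _ hf hg, Pi.add_apply, mul_add]

theorem potential_smul (m c : ℝ) (f : Spacetime → ℝ) :
    potential ε m (c • f) = c • potential ε m f := by
  funext x
  simp only [potential, Pi.smul_apply, smul_eq_mul, mul_neg, ← tsum_mul_left]
  congr 2
  funext k
  rw [iterate_smul, Pi.smul_apply, smul_eq_mul]
  ring

theorem potential_zero (m : ℝ) : potential ε m 0 = 0 := by
  simpa using potential_smul (ε := ε) m 0 0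

theorem TestFunction.hasFDerivAt_potential (hε : ε ^ 2 = 1) (m : ℝ) {f : Spacetime → ℝ}
    (hf : f ∈ TestFunction) (x : Spacetime) :
    HasFDerivAt (potential ε m f) (covector fun i => potential ε m (partialDeriv i f) x) x := by
  choose D hD using fun i =>
    TestFunction.exists_expBound_wavePotential hε m (partialDeriv_mem_testFunction hf i)
  set U : Set Spacetime := {y | (|m| + 1) * (ε * y 0) < (|m| + 1) * (ε * x 0) + 1} with hU
  have hUo : IsOpen U := isOpen_lt (by fun_prop) (by fun_prop)
  have hUc : IsPreconnected U := by
    refine (convex_halfSpace_lt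
      (f := fun y : Spacetime => (|m| + 1) * (ε * y 0)) ?_ _).isPreconnected
    exact ⟨fun a b => by simp only [Pi.add_apply]; ring,
      fun c a => by simp only [Pi.smul_apply, smul_eq_mul]; ring⟩
  have h := hasFDerivAt_tsum_of_isPreconnected (𝕜 := ℝ) (x₀ := x) (x := x)
    (f := fun (k : ℕ) y => (-m ^ 2) ^ k * (wavePotential ε)^[k + 1] f y)
    (f' := fun k y => covector fun i =>
      (-m ^ 2) ^ k * (wavePotential ε)^[k + 1] (partialDeriv i f) y)
    (u := fun k => ∑ i, D i * Real.exp ((|m| + 1) * (ε * x 0) + 1) *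
      (m ^ 2 / (|m| + 1) ^ 2) ^ k)
    (summable_sum fun i _ => (summable_ratio m).mul_left _) hUo hUc ?_ ?_
    (by simp [hU]) (TestFunction.summable hε m hf x) (by simp [hU])
  · refine h.neg.congr_fderiv ?_
    simp only [covector, potential]
    rw [Summable.tsum_finsetSum, ← Finset.sum_neg_distrib]
    · refine Finset.sum_congr rfl fun i _ => ?_
      rw [(TestFunction.summable hε m (partialDeriv_mem_testFunction hf i) x).tsum_smul_const]
      exact (neg_smul _ _).symm
    · intro i _
      exact (TestFunction.summable hε m (partialDeriv_mem_testFunction hf i) x).smul_const _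
  · intro k y _
    refine ((TestFunction.hasFDerivAt_iterate hε (k + 1) hf y).const_mul _).congr_fderiv ?_
    simp only [covector, Finset.smul_sum, smul_smul]
  · intro k y hy
    refine (norm_covector_le _).trans (Finset.sum_le_sum fun i _ => ?_)
    refine ((hD i).term_le hε m k y).trans ?_
    have := (hD i).nonneg
    have hy' : (|m| + 1) * (ε * y 0) ≤ (|m| + 1) * (ε * x 0) + 1 := le_of_lt hy
    gcongr

theorem TestFunction.contDiff_potential (hε : ε ^ 2 = 1) (m : ℝ) {f : Spacetime → ℝ}
    (hf : f ∈ TestFunction) : ContDiff ℝ ∞ (potential ε m f) := by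
  refine contDiff_of_forall_hasFDerivAt (potential ε m '' TestFunction) ?_ ⟨f, hf, rfl⟩
  rintro _ ⟨g, hg, rfl⟩
  exact ⟨fun i => potential ε m (partialDeriv i g),
    fun i => ⟨_, partialDeriv_mem_testFunction hg i, rfl⟩,
    TestFunction.hasFDerivAt_potential hε m hg⟩

theorem TestFunction.partialDeriv_potential (hε : ε ^ 2 = 1) (m : ℝ) {f : Spacetime → ℝ}
    (hf : f ∈ TestFunction) (i : Fin 4) :
    partialDeriv i (potential ε m f) = potential ε m (partialDeriv i f) :=
  funext fun x => partialDeriv_eq_of_hasFDerivAt (TestFunction.hasFDerivAt_potential hε m hf x) i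

theorem kleinGordonFun_eq_smul (m : ℝ) (f : Spacetime → ℝ) :
    kleinGordonFun m f = (-1 : ℝ) • partialDeriv 0 (partialDeriv 0 f)
      + partialDeriv 1 (partialDeriv 1 f) + partialDeriv 2 (partialDeriv 2 f)
      + partialDeriv 3 (partialDeriv 3 f) + (-m ^ 2) • f := by
  funext x
  simp only [kleinGordonFun, Pi.add_apply, Pi.smul_apply, smul_eq_mul]
  ring

theorem TestFunction.kleinGordonFun_potential (hε : ε ^ 2 = 1) (m : ℝ) {f : Spacetime → ℝ}
    (hf : f ∈ TestFunction) :
    kleinGordonFun m (potential ε m f) = potential ε m (kleinGordonFun m f) := by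
  have h2 : ∀ i, partialDeriv i (partialDeriv i f) ∈ TestFunction := fun i =>
    partialDeriv_mem_testFunction (partialDeriv_mem_testFunction hf i) i
  have h0 := TestFunction.smul_mem (-1) (h2 0)
  have h01 := TestFunction.add_mem h0 (h2 1)
  have h012 := TestFunction.add_mem h01 (h2 2)
  have h0123 := TestFunction.add_mem h012 (h2 3)
  have hm := TestFunction.smul_mem (-m ^ 2) hf
  rw [kleinGordonFun_eq_smul, kleinGordonFun_eq_smul, potential_add hε m h0123 hm,
    potential_add hε m h012 (h2 3), potential_add hε m h01 (h2 2), potential_add hε m h0 (h2 1),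
    potential_smul, potential_smul]
  simp only [partialDeriv_potential hε m hf,
    partialDeriv_potential hε m (partialDeriv_mem_testFunction hf _)]

/-- Applied to `P f = □f - m² f`, the Neumann series telescopes. -/
theorem TestFunction.potential_kleinGordonFun (hε : ε ^ 2 = 1) (m : ℝ) {f : Spacetime → ℝ}
    (hf : f ∈ TestFunction) : potential ε m (kleinGordonFun m f) = f := by
  have hP : kleinGordonFun m f = kleinGordonFun 0 f + (-m ^ 2) • f := by
    rw [kleinGordonFun_eq_smul m, kleinGordonFun_eq_smul 0]
    simp
  have hK : ∀ k : ℕ, (wavePotential ε)^[k + 1] (kleinGordonFun m f)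
      = (-1 : ℝ) • (wavePotential ε)^[k] f + (-m ^ 2) • (wavePotential ε)^[k + 1] f := fun k => by
    rw [hP, iterate_add hε _ (kleinGordonFun_mem_testFunction 0 hf)
      (TestFunction.smul_mem _ hf), iterate_smul, Function.iterate_succ_apply,
      wavePotential_wave hε hf, ← neg_one_smul ℝ f, iterate_smul]
  funext x
  obtain ⟨C, hC⟩ := TestFunction.exists_expBound ε (|m| + 1) hf
  have hs := hC.summable hε m x
  have hs' := (summable_nat_add_iff 1).2 hs
  have h1 := hs.tsum_eq_zero_add
  have e : ∀ k : ℕ, (-m ^ 2) ^ k * (wavePotential ε)^[k + 1] (kleinGordonFun m f) x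
      = (-m ^ 2) ^ (k + 1) * (wavePotential ε)^[k + 1] f x
        - (-m ^ 2) ^ k * (wavePotential ε)^[k] f x := fun k => by
    rw [hK]
    simp only [Pi.add_apply, Pi.smul_apply, smul_eq_mul]
    ring
  simp only [potential, e]
  rw [hs'.tsum_sub hs, h1]
  simp

theorem potential_congr (hε : ε ^ 2 = 1) (m : ℝ) {f g : Spacetime → ℝ} {p : Spacetime}
    (h : EqOn f g (cone (-ε) p)) : EqOn (potential ε m f) (potential ε m g) (cone (-ε) p) := by
  have hε' : (-ε) ^ 2 = 1 := by rw [neg_sq, hε]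
  have key : ∀ k, EqOn ((wavePotential ε)^[k] f) ((wavePotential ε)^[k] g) (cone (-ε) p) := by
    intro k
    induction k with
    | zero => exact h
    | succ k ih =>
      simp only [Function.iterate_succ', Function.comp_apply]
      intro x hx
      exact wavePotential_congr hε fun y hy => ih (cone_trans hε' hx hy)
  intro x hx
  simp only [potential, key _ hx]

/-! ### Fundamental solutions on functions with past compact support -/

theorem eventuallyEq_potential (hε : ε ^ 2 = 1) (m : ℝ) {f g : Spacetime → ℝ} {p : Spacetime}
    (h : EqOn f g (cone (-ε) (later ε p))) : potential ε m f =ᶠ[𝓝 p] potential ε m g := by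
  filter_upwards [cone_later_mem_nhds hε (self_mem_cone p)] with x hx
  exact potential_congr hε m h hx

theorem exists_testFunction_eqOn {f : Spacetime → ℝ} (hf : ContDiff ℝ ∞ f)
    (hs : PastCompact ε (tsupport f)) (p : Spacetime) :
    ∃ g ∈ TestFunction, EqOn f g (cone (-ε) p) := by
  obtain ⟨g, hg, hgc, hfg⟩ := exists_hasCompactSupport_eqOn_cone hf (hs p)
  exact ⟨g, ⟨hg, hgc⟩, hfg⟩

theorem contDiff_potential (hε : ε ^ 2 = 1) (m : ℝ) {f : Spacetime → ℝ} (hf : ContDiff ℝ ∞ f)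
    (hs : PastCompact ε (tsupport f)) : ContDiff ℝ ∞ (potential ε m f) := by
  refine contDiff_iff_contDiffAt.2 fun p => ?_
  obtain ⟨g, hg, hfg⟩ := exists_testFunction_eqOn hf hs (later ε p)
  exact (TestFunction.contDiff_potential hε m hg).contDiffAt.congr_of_eventuallyEq
    (eventuallyEq_potential hε m hfg)

theorem potential_kleinGordonFun (hε : ε ^ 2 = 1) (m : ℝ) {f : Spacetime → ℝ}
    (hf : ContDiff ℝ ∞ f) (hs : PastCompact ε (tsupport f)) :
    potential ε m (kleinGordonFun m f) = f := by
  have hε' : (-ε) ^ 2 = 1 := by rw [neg_sq, hε]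
  funext p
  obtain ⟨g, hg, hfg⟩ := exists_testFunction_eqOn hf hs (later ε p)
  have h : EqOn (kleinGordonFun m f) (kleinGordonFun m g) (cone (-ε) p) := fun x hx => by
    refine Filter.EventuallyEq.kleinGordonFun_eq m ?_
    filter_upwards [cone_later_mem_nhds hε hx] with y hy using hfg hy
  rw [potential_congr hε m h (self_mem_cone p), TestFunction.potential_kleinGordonFun hε m hg]
  exact (hfg (mem_of_mem_nhds (cone_later_mem_nhds hε (self_mem_cone p)))).symm

theorem kleinGordonFun_potential (hε : ε ^ 2 = 1) (m : ℝ) {f : Spacetime → ℝ}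
    (hf : ContDiff ℝ ∞ f) (hs : PastCompact ε (tsupport f)) :
    kleinGordonFun m (potential ε m f) = f := by
  funext p
  obtain ⟨g, hg, hfg⟩ := exists_testFunction_eqOn hf hs (later ε p)
  rw [(eventuallyEq_potential hε m hfg).kleinGordonFun_eq,
    TestFunction.kleinGordonFun_potential hε m hg, TestFunction.potential_kleinGordonFun hε m hg]
  exact (hfg (mem_of_mem_nhds (cone_later_mem_nhds hε (self_mem_cone p)))).symm

theorem potential_add (hε : ε ^ 2 = 1) (m : ℝ) {f g : Spacetime → ℝ}
    (hf : ContDiff ℝ ∞ f) (hfs : PastCompact ε (tsupport f))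
    (hg : ContDiff ℝ ∞ g) (hgs : PastCompact ε (tsupport g)) :
    potential ε m (f + g) = potential ε m f + potential ε m g := by
  funext p
  obtain ⟨f', hf', hff'⟩ := exists_testFunction_eqOn hf hfs p
  obtain ⟨g', hg', hgg'⟩ := exists_testFunction_eqOn hg hgs p
  have h : EqOn (f + g) (f' + g') (cone (-ε) p) := fun x hx => by
    simp only [Pi.add_apply, hff' hx, hgg' hx]
  rw [potential_congr hε m h (self_mem_cone p), TestFunction.potential_add hε m hf' hg',
    Pi.add_apply, Pi.add_apply, potential_congr hε m hff' (self_mem_cone p),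
    potential_congr hε m hgg' (self_mem_cone p)]

theorem tsupport_potential_subset (hε : ε ^ 2 = 1) (m : ℝ) {f : Spacetime → ℝ}
    (hs : PastCompact ε (tsupport f)) :
    tsupport (potential ε m f) ⊆ coneSet ε (tsupport f) := by
  refine closure_minimal (fun p hp => ?_) (hs.isClosed_coneSet hε)
  by_contra hpc
  have h : EqOn f 0 (cone (-ε) p) := fun x hx => image_eq_zero_of_notMem_tsupport fun hxf =>
    hpc (mem_coneSet.2 ⟨x, hxf, mem_cone_neg_iff.1 hx⟩)
  exact hp (by rw [potential_congr hε m h (self_mem_cone p), potential_zero, Pi.zero_apply])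

/-- A solution of `P u = f` with past compact support is unique. -/
theorem eq_of_kleinGordonFun_eq (hε : ε ^ 2 = 1) {m : ℝ} {u v : Spacetime → ℝ}
    (hu : ContDiff ℝ ∞ u) (hus : PastCompact ε (tsupport u))
    (hv : ContDiff ℝ ∞ v) (hvs : PastCompact ε (tsupport v))
    (h : kleinGordonFun m u = kleinGordonFun m v) : u = v := by
  rw [← potential_kleinGordonFun hε m hu hus, h, potential_kleinGordonFun hε m hv hvs]

/-- `potential` as an operator on timelike compact functions. -/
def potentialTC (hε : ε ^ 2 = 1) (m : ℝ)
    (h : ∀ α : TimelikeCompact, PastCompact ε (tsupport (α : Spacetime → ℝ))) :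
    TimelikeCompact →ₗ[ℝ] Smooth where
  toFun α := ⟨potential ε m α, contDiff_potential hε m α.2.1 (h α)⟩
  map_add' α β := Subtype.ext (potential_add hε m α.2.1 (h α) β.2.1 (h β))
  map_smul' c α := Subtype.ext (potential_smul m c (α : Spacetime → ℝ))

theorem isFundamentalSolution_potentialTC (hε : ε ^ 2 = 1) (m : ℝ)
    (h : ∀ α : TimelikeCompact, PastCompact ε (tsupport (α : Spacetime → ℝ))) :
    IsFundamentalSolution m (coneSet ε) (potentialTC hε m h) where
  kleinGordon_apply α := kleinGordonFun_potential hε m α.2.1 (h α)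
  apply_kleinGordon α := potential_kleinGordonFun hε m α.2.1 (h α)
  support_subset α := tsupport_potential_subset hε m (h α)

theorem IsFundamentalSolution.pastCompact (hε : ε ^ 2 = 1) {m : ℝ}
    {G : TimelikeCompact →ₗ[ℝ] Smooth} (hG : IsFundamentalSolution m (coneSet ε) G)
    {α : TimelikeCompact} (h : PastCompact ε (tsupport (α : Spacetime → ℝ))) :
    PastCompact ε (tsupport (G α : Spacetime → ℝ)) :=
  (h.coneSet hε).mono (isClosed_tsupport _) (hG.support_subset α)

theorem IsFundamentalSolution.apply_eq (hε : ε ^ 2 = 1) {m : ℝ}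
    {G : TimelikeCompact →ₗ[ℝ] Smooth} (hG : IsFundamentalSolution m (coneSet ε) G)
    {α : TimelikeCompact} (h : PastCompact ε (tsupport (α : Spacetime → ℝ)))
    {u : Spacetime → ℝ} (hu : ContDiff ℝ ∞ u) (hus : PastCompact ε (tsupport u))
    (huα : kleinGordonFun m u = α) : (G α : Spacetime → ℝ) = u :=
  eq_of_kleinGordonFun_eq hε (G α).2 (hG.pastCompact hε h) hu hus
    ((hG.kleinGordon_apply α).trans huα.symm)

theorem TimelikeCompact.pastCompact (α : TimelikeCompact) :
    PastCompact 1 (tsupport (α : Spacetime → ℝ)) := (isTimelikeCompact_iff.1 α.2.2).1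

theorem TimelikeCompact.futureCompact (α : TimelikeCompact) :
    PastCompact (-1) (tsupport (α : Spacetime → ℝ)) := (isTimelikeCompact_iff.1 α.2.2).2

theorem existsUnique_isFundamentalPair (m : ℝ) : ∃! G, IsFundamentalPair m G := by
  have h1 : (1 : ℝ) ^ 2 = 1 := one_pow 2
  have h2 : (-1 : ℝ) ^ 2 = 1 := by norm_num
  have e1 := isFundamentalSolution_potentialTC h1 m TimelikeCompact.pastCompact
  have e2 := isFundamentalSolution_potentialTC h2 m TimelikeCompact.futureCompact
  refine ⟨(potentialTC h1 m TimelikeCompact.pastCompact,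
    potentialTC h2 m TimelikeCompact.futureCompact), ?_, ?_⟩
  · exact ⟨causalFutureSet_eq_coneSet ▸ e1, causalPastSet_eq_coneSet ▸ e2⟩
  · rintro ⟨G, G'⟩ ⟨hG1, hG2⟩
    rw [causalFutureSet_eq_coneSet] at hG1
    rw [causalPastSet_eq_coneSet] at hG2
    refine Prod.ext (LinearMap.ext fun α => Subtype.ext ?_) (LinearMap.ext fun α => Subtype.ext ?_)
    · exact hG1.apply_eq h1 (TimelikeCompact.pastCompact α) (Subtype.prop _)
        (e1.pastCompact h1 (TimelikeCompact.pastCompact α))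
        (e1.kleinGordon_apply α)
    · exact hG2.apply_eq h2 (TimelikeCompact.futureCompact α) (Subtype.prop _)
        (e2.pastCompact h2 (TimelikeCompact.futureCompact α)) (e2.kleinGordon_apply α)

theorem isFundamentalPair_fundamentalPair (m : ℝ) : IsFundamentalPair m (fundamentalPair m) := by
  have h := (existsUnique_isFundamentalPair m).exists
  rw [fundamentalPair, dif_pos h]
  exact h.choose_spec

theorem isFundamentalSolution_fst (m : ℝ) :
    IsFundamentalSolution m (coneSet 1) (fundamentalPair m).1 :=
  causalFutureSet_eq_coneSet ▸ (isFundamentalPair_fundamentalPair m).1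

theorem isFundamentalSolution_snd (m : ℝ) :
    IsFundamentalSolution m (coneSet (-1)) (fundamentalPair m).2 :=
  causalPastSet_eq_coneSet ▸ (isFundamentalPair_fundamentalPair m).2

theorem kleinGordon_causalPropagator (m : ℝ) (α : TimelikeCompact) :
    kleinGordon m (causalPropagator m α) = 0 := by
  rw [causalPropagator, LinearMap.sub_apply, map_sub, sub_eq_zero]
  exact Subtype.ext (((isFundamentalSolution_fst m).kleinGordon_apply α).trans
    ((isFundamentalSolution_snd m).kleinGordon_apply α).symm)

theorem causalPropagator_eq {m : ℝ} {α : TimelikeCompact} {u v : Spacetime → ℝ}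
    (hu : ContDiff ℝ ∞ u) (hus : PastCompact 1 (tsupport u)) (huα : kleinGordonFun m u = α)
    (hv : ContDiff ℝ ∞ v) (hvs : PastCompact (-1) (tsupport v)) (hvα : kleinGordonFun m v = α) :
    (causalPropagator m α : Spacetime → ℝ) = u - v := by
  have e1 := (isFundamentalSolution_fst m).apply_eq (by norm_num)
    (TimelikeCompact.pastCompact α) hu hus huα
  have e2 := (isFundamentalSolution_snd m).apply_eq (by norm_num)
    (TimelikeCompact.futureCompact α) hv hvs hvα
  rw [causalPropagator, LinearMap.sub_apply, Submodule.coe_sub, e1, e2]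

/-! ### Reflection and the odd extension -/

theorem reflect_reflect (x : Spacetime) : reflect (reflect x) = x := by
  funext i
  fin_cases i <;> simp [reflect]

theorem reflect_eq_self {x : Spacetime} (hx : x 3 = 0) : reflect x = x := by
  funext i
  fin_cases i <;> simp [reflect, hx]

theorem reflect_mem_cone {p q : Spacetime} (h : q ∈ cone ε p) : reflect q ∈ cone ε (reflect p) := by
  obtain ⟨h1, h2⟩ := h
  refine ⟨by simpa [reflect] using h1, ?_⟩
  simp only [reflect, Matrix.cons_val_zero, Matrix.cons_val_one, Matrix.cons_val]
  linarith [show (-q 3 - -p 3) ^ 2 = (q 3 - p 3) ^ 2 by ring]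

theorem PastCompact.comp_reflect {f : Spacetime → ℝ} (h : PastCompact ε (tsupport f)) :
    PastCompact ε (tsupport fun x => f (reflect x)) := by
  have hc : Continuous reflect := contDiff_reflect.continuous
  have hsub : tsupport (fun x => f (reflect x)) ⊆ reflect ⁻¹' tsupport f :=
    closure_minimal (fun x hx => subset_tsupport f hx) ((isClosed_tsupport f).preimage hc)
  refine PastCompact.mono (A := reflect ⁻¹' tsupport f) (fun q => ?_) (isClosed_tsupport _) hsub
  refine ((h (reflect q)).image hc).of_isClosed_subset
    (((isClosed_tsupport f).preimage hc).inter (isClosed_cone q)) fun x hx => ?_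
  exact ⟨reflect x, ⟨hx.1, reflect_mem_cone hx.2⟩, reflect_reflect x⟩

theorem PastCompact.neg_comp_reflect {f : Spacetime → ℝ} (h : PastCompact ε (tsupport f)) :
    PastCompact ε (tsupport (-fun x => f (reflect x))) := by
  have : tsupport (-fun x => f (reflect x)) = tsupport fun x => f (reflect x) := by
    simp only [tsupport, Function.support_neg]
  rw [this]
  exact h.comp_reflect

theorem kleinGordonFun_neg_comp_reflect (m : ℝ) {f : Spacetime → ℝ} (hf : ContDiff ℝ ∞ f)
    (x : Spacetime) :
    kleinGordonFun m (-fun y => f (reflect y)) x = -kleinGordonFun m f (reflect x) :=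
  (kleinGordonFun_neg m (f := fun y => f (reflect y)) (hf.comp contDiff_reflect) x).trans
    (congrArg Neg.neg (kleinGordonFun_comp_reflect m hf x))

theorem halfSpace_subset_closure : halfSpace ⊆ closure {x : Spacetime | 0 < x 3} := by
  intro x hx
  have hx : 0 ≤ x 3 := hx
  refine mem_closure_of_tendsto (b := 𝓝[>] (0 : ℝ))
    (f := fun t => x + t • (Pi.single 3 1 : Spacetime)) ?_ ?_
  · have h : Continuous fun t : ℝ => x + t • (Pi.single 3 1 : Spacetime) := by
      fun_prop
    simpa using (h.tendsto 0).mono_left nhdsWithin_le_nhds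
  · filter_upwards [self_mem_nhdsWithin] with t ht
    have ht : 0 < t := ht
    simp only [Pi.add_apply, Pi.smul_apply, Pi.single_eq_same, smul_eq_mul, mul_one]
    linarith

theorem eqOn_halfSpace {f g : Spacetime → ℝ} (hf : Continuous f) (hg : Continuous g)
    (h : ∀ x : Spacetime, 0 < x 3 → f x = g x) : EqOn f g halfSpace :=
  (EqOn.closure (s := {x : Spacetime | 0 < x 3}) h hf hg).mono halfSpace_subset_closure

theorem eventually_pos {x : Spacetime} (hx : 0 < x 3) : ∀ᶠ y : Spacetime in 𝓝 x, 0 < y 3 :=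
  (isOpen_lt continuous_const (continuous_apply 3)).mem_nhds hx

theorem eventually_neg {x : Spacetime} (hx : x 3 < 0) : ∀ᶠ y : Spacetime in 𝓝 x, y 3 < 0 :=
  (isOpen_lt (continuous_apply 3) continuous_const).mem_nhds hx

theorem partialDeriv_eq_zero_of_halfSpace {f : Spacetime → ℝ} (hf : ContDiff ℝ ∞ f)
    (h : ∀ x ∈ halfSpace, f x = 0) (i : Fin 4) : ∀ x ∈ halfSpace, partialDeriv i f x = 0 := by
  refine eqOn_halfSpace (contDiff_partialDeriv i hf).continuous continuous_const fun x hx => ?_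
  have h0 : f =ᶠ[𝓝 x] fun _ => 0 := by
    filter_upwards [eventually_pos hx] with y hy using h y hy.le
  rw [(h0.partialDeriv i).eq_of_nhds]
  simp [partialDeriv]

theorem partialDeriv_eq_zero_of_boundary {f : Spacetime → ℝ} (hf : ContDiff ℝ ∞ f)
    (h : ∀ x : Spacetime, x 3 = 0 → f x = 0) {i : Fin 4} (hi : i ≠ 3) :
    ∀ x : Spacetime, x 3 = 0 → partialDeriv i f x = 0 := by
  intro x hx
  have hline : HasDerivAt (fun t : ℝ => x + t • (Pi.single i 1 : Spacetime)) (Pi.single i 1) 0 := by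
    simpa using ((hasDerivAt_id (0 : ℝ)).smul_const (Pi.single i 1 : Spacetime)).const_add x
  have hd : HasFDerivAt f (fderiv ℝ f x) (x + (0 : ℝ) • (Pi.single i 1 : Spacetime)) := by
    simpa using (differentiable_of_contDiff hf x).hasFDerivAt
  have h1 := hd.comp_hasDerivAt (0 : ℝ) hline
  have h2 : f ∘ (fun t : ℝ => x + t • (Pi.single i 1 : Spacetime)) = fun _ => 0 := by
    funext t
    refine h _ ?_
    simp [hx, hi.symm]
  rw [h2] at h1
  exact h1.unique (hasDerivAt_const 0 0)

theorem kleinGordonFun_partialDeriv (m : ℝ) {f : Spacetime → ℝ} (hf : ContDiff ℝ ∞ f)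
    (i : Fin 4) : kleinGordonFun m (partialDeriv i f) = partialDeriv i (kleinGordonFun m f) := by
  have h1 : ∀ j, ContDiff ℝ ∞ (partialDeriv j f) := fun j => contDiff_partialDeriv j hf
  have h2 : ∀ j, ContDiff ℝ ∞ (partialDeriv j (partialDeriv j f)) := fun j =>
    contDiff_partialDeriv j (h1 j)
  have hc : ∀ j, partialDeriv j (partialDeriv j (partialDeriv i f))
      = partialDeriv i (partialDeriv j (partialDeriv j f)) := fun j => by
    rw [funext (partialDeriv_comm hf j i), funext (partialDeriv_comm (h1 j) j i)]
  have a0 := Smooth.smul_mem (-1) (h2 0)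
  have a1 := Smooth.add_mem a0 (h2 1)
  have a2 := Smooth.add_mem a1 (h2 2)
  have a3 := Smooth.add_mem a2 (h2 3)
  have am := Smooth.smul_mem (-m ^ 2) hf
  rw [kleinGordonFun_eq_smul, kleinGordonFun_eq_smul, partialDeriv_add i a3 am,
    partialDeriv_add i a2 (h2 3), partialDeriv_add i a1 (h2 2), partialDeriv_add i a0 (h2 1),
    partialDeriv_smul i _ (h2 0), partialDeriv_smul i _ hf]
  simp only [hc]

open Classical in
/-- The extension of `v` from the half-space by `v(ι_z x) = σ v(x)`: even for `σ = 1` and odd for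
`σ = -1`. -/
def reflectExt (σ : ℝ) (v : Spacetime → ℝ) (x : Spacetime) : ℝ :=
  if 0 ≤ x 3 then v x else σ * v (reflect x)

theorem reflectExt_of_nonneg (σ : ℝ) (v : Spacetime → ℝ) {x : Spacetime} (hx : 0 ≤ x 3) :
    reflectExt σ v x = v x := if_pos hx

theorem reflectExt_of_neg (σ : ℝ) (v : Spacetime → ℝ) {x : Spacetime} (hx : x 3 < 0) :
    reflectExt σ v x = σ * v (reflect x) := if_neg (not_le.2 hx)

theorem hasFDerivAt_reflectExt {σ : ℝ} {v : Spacetime → ℝ} (hv : ContDiff ℝ ∞ v)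
    (h0 : ∀ x : Spacetime, x 3 = 0 → v x = σ * v x)
    (h1 : ∀ i, ∀ x : Spacetime, x 3 = 0 →
      partialDeriv i v x = σ * (if i = 3 then -1 else 1) * partialDeriv i v x) (x : Spacetime) :
    HasFDerivAt (reflectExt σ v) (covector fun i =>
      reflectExt (σ * (if i = 3 then -1 else 1)) (partialDeriv i v) x) x := by
  have hd : HasFDerivAt v (covector fun i => partialDeriv i v x) x :=
    hasFDerivAt_covector (differentiable_of_contDiff hv x)
  have hr : HasFDerivAt (fun y => σ * v (reflect y)) (covector fun i =>
      σ * (if i = 3 then -1 else 1) * partialDeriv i v (reflect x)) x := by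
    have hvr : ContDiff ℝ ∞ fun y => σ * v (reflect y) :=
      contDiff_const.mul (hv.comp contDiff_reflect)
    convert hasFDerivAt_covector (differentiable_of_contDiff hvr x) using 3 with i
    have e := congrFun (partialDeriv_smul i σ (f := fun y => v (reflect y))
      (hv.comp contDiff_reflect)) x
    have e' : (σ • fun y => v (reflect y)) = fun y => σ * v (reflect y) := rfl
    rw [e'] at e
    rw [e, Pi.smul_apply, smul_eq_mul, partialDeriv_comp_reflect i hv, mul_assoc]
  rcases lt_trichotomy (x 3) 0 with hx | hx | hx
  · simp only [reflectExt_of_neg _ _ hx]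
    refine hr.congr_of_eventuallyEq ?_
    filter_upwards [eventually_neg hx] with y hy using reflectExt_of_neg σ v hy
  · simp only [reflectExt_of_nonneg _ _ hx.ge]
    have hr' : HasFDerivAt (fun y => σ * v (reflect y))
        (covector fun i => partialDeriv i v x) x := by
      convert hr using 3 with i
      rw [reflect_eq_self hx]
      exact h1 i x hx
    have hu := (hd.hasFDerivWithinAt (s := {y : Spacetime | 0 ≤ y 3})).congr
      (f₁ := reflectExt σ v)
      (fun y hy => reflectExt_of_nonneg σ v hy) (reflectExt_of_nonneg σ v hx.ge)
    have hl := (hr'.hasFDerivWithinAt (s := {y : Spacetime | y 3 ≤ 0})).congr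
      (f₁ := reflectExt σ v) (fun y hy => ?_) ?_
    · have h := hu.union hl
      have huniv : {y : Spacetime | 0 ≤ y 3} ∪ {y : Spacetime | y 3 ≤ 0} = univ :=
        eq_univ_of_forall fun y => le_total 0 (y 3)
      rwa [huniv, hasFDerivWithinAt_univ] at h
    · rcases (show y 3 ≤ 0 from hy).lt_or_eq with hy | hy
      · exact reflectExt_of_neg σ v hy
      · simp only [reflectExt_of_nonneg _ _ hy.ge, reflect_eq_self hy]
        exact h0 y hy
    · simp only [reflectExt_of_nonneg _ _ hx.ge, reflect_eq_self hx]
      exact h0 x hx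
  · simp only [reflectExt_of_nonneg _ _ hx.le]
    refine hd.congr_of_eventuallyEq ?_
    filter_upwards [eventually_pos hx] with y hy using reflectExt_of_nonneg σ v hy.le

/-- The odd extension of a solution with Dirichlet boundary values is smooth: all its partial
derivatives are even extensions of solutions with Neumann boundary values or odd extensions of
solutions with Dirichlet boundary values. The second normal derivative of a Dirichlet solution
vanishes on the boundary because, by the equation, it is a combination of tangential derivatives. -/
theorem contDiff_reflectExt {m : ℝ} {v : Spacetime → ℝ} (hv : ContDiff ℝ ∞ v)
    (hP : ∀ x ∈ halfSpace, kleinGordonFun m v x = 0)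
    (h0 : ∀ x : Spacetime, x 3 = 0 → v x = 0) : ContDiff ℝ ∞ (reflectExt (-1) v) := by
  refine contDiff_of_forall_hasFDerivAt
    {f | ∃ v, ContDiff ℝ ∞ v ∧ (∀ x ∈ halfSpace, kleinGordonFun m v x = 0) ∧
      (((∀ x : Spacetime, x 3 = 0 → v x = 0) ∧ f = reflectExt (-1) v) ∨
       ((∀ x : Spacetime, x 3 = 0 → partialDeriv 3 v x = 0) ∧ f = reflectExt 1 v))} ?_
    ⟨v, hv, hP, Or.inl ⟨h0, rfl⟩⟩
  clear hP h0 hv v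
  rintro f ⟨v, hv, hP, hf⟩
  have hv1 : ∀ i, ContDiff ℝ ∞ (partialDeriv i v) := fun i => contDiff_partialDeriv i hv
  have hP1 : ∀ i, ∀ x ∈ halfSpace, kleinGordonFun m (partialDeriv i v) x = 0 := fun i x hx => by
    rw [kleinGordonFun_partialDeriv m hv]
    exact partialDeriv_eq_zero_of_halfSpace (contDiff_kleinGordonFun m hv) hP i x hx
  rcases hf with ⟨h0, rfl⟩ | ⟨h0, rfl⟩
  · have ht : ∀ {i : Fin 4}, i ≠ 3 → ∀ x : Spacetime, x 3 = 0 → partialDeriv i v x = 0 :=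
      fun hi => partialDeriv_eq_zero_of_boundary hv h0 hi
    refine ⟨_, fun i => ⟨partialDeriv i v, hv1 i, hP1 i, ?_⟩,
      hasFDerivAt_reflectExt hv (fun x hx => by simp [h0 x hx]) fun i x hx => ?_⟩
    · by_cases hi : i = 3
      · subst hi
        refine Or.inr ⟨fun x hx => ?_, by simp⟩
        have h := hP x (le_of_eq hx.symm)
        rw [kleinGordonFun, h0 x hx,
          partialDeriv_eq_zero_of_boundary (hv1 0) (ht (by decide)) (by decide) x hx,
          partialDeriv_eq_zero_of_boundary (hv1 1) (ht (by decide)) (by decide) x hx,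
          partialDeriv_eq_zero_of_boundary (hv1 2) (ht (by decide)) (by decide) x hx] at h
        linarith
      · exact Or.inl ⟨ht hi, by simp [hi]⟩
    · by_cases hi : i = 3
      · simp [hi]
      · simp [ht hi x hx]
  · refine ⟨_, fun i => ⟨partialDeriv i v, hv1 i, hP1 i, ?_⟩,
      hasFDerivAt_reflectExt hv (fun x hx => by simp) fun i x hx => ?_⟩
    · by_cases hi : i = 3
      · subst hi
        exact Or.inl ⟨h0, by simp⟩
      · refine Or.inr ⟨fun x hx => ?_, by simp [hi]⟩
        rw [partialDeriv_comm hv]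
        exact partialDeriv_eq_zero_of_boundary (hv1 3) h0 hi x hx
    · by_cases hi : i = 3
      · subst hi
        simp [h0 x hx]
      · simp [hi]

theorem reflectExt_neg_one_odd {v : Spacetime → ℝ} (h0 : ∀ x : Spacetime, x 3 = 0 → v x = 0)
    (x : Spacetime) : reflectExt (-1) v x = -reflectExt (-1) v (reflect x) := by
  have e : reflect x 3 = -x 3 := by simp [reflect]
  rcases lt_trichotomy (x 3) 0 with hx | hx | hx
  · rw [reflectExt_of_neg _ _ hx, reflectExt_of_nonneg _ _ (by linarith), neg_one_mul]
  · rw [reflect_eq_self hx, reflectExt_of_nonneg _ _ hx.ge, h0 x hx, neg_zero]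
  · rw [reflectExt_of_nonneg _ _ hx.le, reflectExt_of_neg _ _ (by linarith), reflect_reflect]
    ring

theorem kleinGordonFun_odd (m : ℝ) {w : Spacetime → ℝ} (hw : ContDiff ℝ ∞ w)
    (hodd : ∀ x, w x = -w (reflect x)) (x : Spacetime) :
    kleinGordonFun m w x = -kleinGordonFun m w (reflect x) := by
  have h : w = -fun x => w (reflect x) := funext hodd
  conv_lhs => rw [h]
  exact kleinGordonFun_neg_comp_reflect m hw x

theorem kleinGordonFun_reflectExt {m : ℝ} {v : Spacetime → ℝ} (hv : ContDiff ℝ ∞ v)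
    (hP : ∀ x ∈ halfSpace, kleinGordonFun m v x = 0)
    (h0 : ∀ x : Spacetime, x 3 = 0 → v x = 0) : kleinGordonFun m (reflectExt (-1) v) = 0 := by
  have hw := contDiff_reflectExt hv hP h0
  have hH : ∀ x ∈ halfSpace, kleinGordonFun m (reflectExt (-1) v) x = 0 := by
    refine eqOn_halfSpace (contDiff_kleinGordonFun m hw).continuous continuous_const fun x hx => ?_
    rw [← hP x hx.le]
    refine Filter.EventuallyEq.kleinGordonFun_eq m ?_
    filter_upwards [eventually_pos hx] with y hy using reflectExt_of_nonneg _ v hy.le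
  funext x
  rcases le_total 0 (x 3) with hx | hx
  · exact hH x hx
  · rw [kleinGordonFun_odd m hw (reflectExt_neg_one_odd h0), hH, neg_zero, Pi.zero_apply]
    change 0 ≤ reflect x 3
    simpa [reflect] using hx

/-- Solutions on a neighbourhood of the half-space may be replaced by globally smooth functions. -/
theorem exists_contDiff_extension {m : ℝ} {O : Set Spacetime} {v : Spacetime → ℝ} (hO : IsOpen O)
    (hsub : halfSpace ⊆ O) (hv : ContDiffOn ℝ ∞ v O)
    (hP : ∀ x ∈ halfSpace, kleinGordonFun m v x = 0) :
    ∃ w, ContDiff ℝ ∞ w ∧ (∀ x ∈ halfSpace, w x = v x) ∧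
      ∀ x ∈ halfSpace, kleinGordonFun m w x = 0 := by
  have hcl : IsClosed halfSpace := isClosed_le continuous_const (continuous_apply 3)
  obtain ⟨χ, hχ0, hχ1, -⟩ := exists_contMDiffMap_zero_one_nhds_of_isClosed (n := ⊤)
    (modelWithCornersSelf ℝ Spacetime) hO.isClosed_compl hcl
    (disjoint_compl_left_iff_subset.2 hsub)
  have hχ : ContDiff ℝ ∞ χ := χ.contMDiff.contDiff
  rw [eventually_nhdsSet_iff_forall] at hχ0 hχ1
  have heq : ∀ x ∈ halfSpace, (fun y => χ y * v y) =ᶠ[𝓝 x] v := fun x hx => by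
    filter_upwards [hχ1 x hx] with y hy
    rw [hy, one_mul]
  refine ⟨fun x => χ x * v x, contDiff_iff_contDiffAt.2 fun x => ?_,
    fun x hx => (heq x hx).eq_of_nhds, fun x hx => ?_⟩
  · by_cases hx : x ∈ O
    · exact hχ.contDiffAt.mul (hv.contDiffAt (hO.mem_nhds hx))
    · refine (contDiffAt_const (c := (0 : ℝ))).congr_of_eventuallyEq ?_
      filter_upwards [hχ0 x hx] with y hy
      rw [hy, zero_mul]
  · rw [(heq x hx).kleinGordonFun_eq, hP x hx]

/-! ### The isomorphism -/

theorem causalPropagator_odd (m : ℝ) (α : TimelikeCompactOdd) (x : Spacetime) :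
    (causalPropagator m (inclTC α) : Spacetime → ℝ) x
      = -(causalPropagator m (inclTC α) : Spacetime → ℝ) (reflect x) := by
  have hα : ∀ x, (inclTC α : Spacetime → ℝ) x = -(inclTC α : Spacetime → ℝ) (reflect x) := α.2.2.2
  have key : ∀ {ε : ℝ}, PastCompact ε (tsupport (inclTC α : Spacetime → ℝ)) →
      ε ^ 2 = 1 → ∀ G, IsFundamentalSolution m (coneSet ε) G →
      PastCompact ε (tsupport (-fun y => (G (inclTC α) : Spacetime → ℝ) (reflect y))) ∧
      ContDiff ℝ ∞ (-fun y => (G (inclTC α) : Spacetime → ℝ) (reflect y)) ∧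
      kleinGordonFun m (-fun y => (G (inclTC α) : Spacetime → ℝ) (reflect y)) = inclTC α := by
    intro ε hs hε G hG
    have hsm : ContDiff ℝ ∞ (G (inclTC α) : Spacetime → ℝ) := (G (inclTC α)).2
    refine ⟨?_, (hsm.comp contDiff_reflect).neg, funext fun y => ?_⟩
    · exact (hG.pastCompact hε hs).neg_comp_reflect
    · rw [kleinGordonFun_neg_comp_reflect m hsm, hα y]
      exact congrArg Neg.neg (congrFun (hG.kleinGordon_apply (inclTC α)) (reflect y))
  have k1 := key (TimelikeCompact.pastCompact _) (by norm_num) _ (isFundamentalSolution_fst m)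
  have k2 := key (TimelikeCompact.futureCompact _) (by norm_num) _ (isFundamentalSolution_snd m)
  have e := causalPropagator_eq k1.2.1 k1.1 k1.2.2 k2.2.1 k2.1 k2.2.2
  rw [congrFun e x, causalPropagator, LinearMap.sub_apply, Submodule.coe_sub]
  simp only [Pi.sub_apply, Pi.neg_apply]
  ring

theorem imagesOperator_apply (m : ℝ) (α : TimelikeCompactOdd) (x : halfSpace) :
    imagesOperator m (inclTC α) x = 2 * (causalPropagator m (inclTC α) : Spacetime → ℝ) x := by
  have h := causalPropagator_odd m α x
  change (causalPropagator m (inclTC α) : Spacetime → ℝ) x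
    - (causalPropagator m (inclTC α) : Spacetime → ℝ) (reflect x) = _
  linarith

theorem imagesOperator_mem (m : ℝ) (α : TimelikeCompact) :
    imagesOperator m α ∈ dynamicalConfigurations m := by
  set w : Smooth := causalPropagator m α - reflectFun (causalPropagator m α) with hw
  have hPw : ∀ x, kleinGordonFun m w x = 0 := fun x => by
    have h0 : ∀ y, kleinGordonFun m (causalPropagator m α : Spacetime → ℝ) y = 0 := fun y =>
      congrFun (congrArg Subtype.val (kleinGordon_causalPropagator m α)) y
    have e := kleinGordonFun_sub m (causalPropagator m α).2
      (reflectFun (causalPropagator m α)).2 x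
    rw [hw, Submodule.coe_sub, e, h0 x]
    change 0 - kleinGordonFun m (fun y => (causalPropagator m α : Spacetime → ℝ) (reflect y)) x = 0
    rw [kleinGordonFun_comp_reflect m (causalPropagator m α).2, h0, sub_zero]
  refine ⟨⟨univ, w, ⟨isOpen_univ, subset_univ _, ?_, fun x => rfl⟩, fun x _ => hPw x⟩,
    fun x hx => ?_⟩
  · exact ContDiff.contDiffOn w.2
  · change (causalPropagator m α : Spacetime → ℝ) x
      - (causalPropagator m α : Spacetime → ℝ) (reflect x) = 0
    rw [reflect_eq_self hx, sub_self]

/-- If `E α` vanishes on the half-space then, being odd, it vanishes everywhere, so that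
`E⁺ α = E⁻ α` is timelike compact and `α = P (E⁺ α)`. -/
theorem ker_imagesOperator_le (m : ℝ) :
    LinearMap.ker (imagesOperator m ∘ₗ inclTC) ≤ LinearMap.range (kleinGordonTCOdd m) := by
  intro α hα
  have h0 : ∀ x, (causalPropagator m (inclTC α) : Spacetime → ℝ) x = 0 := fun x => by
    have hH : ∀ y ∈ halfSpace, (causalPropagator m (inclTC α) : Spacetime → ℝ) y = 0 :=
      fun y hy => by
        have h := imagesOperator_apply m α ⟨y, hy⟩
        have h' : imagesOperator m (inclTC α) ⟨y, hy⟩ = 0 := congrFun hα _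
        linarith
    rcases le_total 0 (x 3) with hx | hx
    · exact hH x hx
    · rw [causalPropagator_odd, hH, neg_zero]
      change 0 ≤ reflect x 3
      simpa [reflect] using hx
  have f1 := isFundamentalSolution_fst m
  have f2 := isFundamentalSolution_snd m
  have heq : ((fundamentalPair m).1 (inclTC α) : Spacetime → ℝ)
      = (fundamentalPair m).2 (inclTC α) := funext fun x => sub_eq_zero.1 (h0 x)
  set β : Smooth := (fundamentalPair m).1 (inclTC α) with hβ
  have c1 : PastCompact 1 (tsupport (β : Spacetime → ℝ)) :=
    f1.pastCompact (by norm_num) (TimelikeCompact.pastCompact _)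
  have c2 : PastCompact (-1) (tsupport (β : Spacetime → ℝ)) := by
    rw [heq]
    exact f2.pastCompact (by norm_num) (TimelikeCompact.futureCompact _)
  have hβα : kleinGordonFun m β = inclTC α := f1.kleinGordon_apply (inclTC α)
  have hα' : ∀ x, (inclTC α : Spacetime → ℝ) x = -(inclTC α : Spacetime → ℝ) (reflect x) := α.2.2.2
  have hβs : ContDiff ℝ ∞ (β : Spacetime → ℝ) := β.2
  have hodd : ∀ x, (β : Spacetime → ℝ) x = -(β : Spacetime → ℝ) (reflect x) := by
    refine congrFun (eq_of_kleinGordonFun_eq (ε := 1) (m := m) (by norm_num) hβs c1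
      (v := -fun y => (β : Spacetime → ℝ) (reflect y)) (hβs.comp contDiff_reflect).neg
      c1.neg_comp_reflect (funext fun y => ?_))
    rw [kleinGordonFun_neg_comp_reflect m hβs, hβα]
    exact hα' y
  exact ⟨⟨β, ⟨hβs, isTimelikeCompact_iff.2 ⟨c1, c2⟩⟩, hβs, hodd⟩, Subtype.ext hβα⟩

/-- Every odd solution `w` of the homogeneous equation is `E α` for `α = P (χ w)`, where `χ` is a
function of time that switches from `0` to `1`. -/
theorem exists_causalPropagator_eq {m : ℝ} {w : Spacetime → ℝ} (hw : ContDiff ℝ ∞ w)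
    (hP : kleinGordonFun m w = 0) (hodd : ∀ x, w x = -w (reflect x)) :
    ∃ α : TimelikeCompactOdd, (causalPropagator m (inclTC α) : Spacetime → ℝ) = w := by
  set u : Spacetime → ℝ := fun x => Real.smoothTransition (x 0) * w x with hu
  have hus : ContDiff ℝ ∞ u := (Real.smoothTransition.contDiff.comp (contDiff_apply ℝ ℝ 0)).mul hw
  have hvs : ContDiff ℝ ∞ (u - w) := hus.sub hw
  have huodd : ∀ x, u x = -u (reflect x) := fun x => by
    have : reflect x 0 = x 0 := by simp [reflect]
    simp only [hu, this]
    rw [hodd x]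
    ring
  have cu : PastCompact 1 (tsupport u) := by
    refine pastCompact_of_le (T := 0) (by norm_num) (isClosed_tsupport u) fun x hx => ?_
    have hcl : IsClosed {y : Spacetime | 0 ≤ y 0} :=
      isClosed_le continuous_const (continuous_apply 0)
    rw [one_mul]
    refine closure_minimal (fun y hy => ?_) hcl hx
    by_contra hy0
    exact hy (by simp [hu, Real.smoothTransition.zero_of_nonpos (not_le.1 hy0).le])
  have cv : PastCompact (-1) (tsupport (u - w)) := by
    refine pastCompact_of_le (T := -1) (by norm_num) (isClosed_tsupport _) fun x hx => ?_
    have hcl : IsClosed {y : Spacetime | y 0 ≤ 1} :=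
      isClosed_le (continuous_apply 0) continuous_const
    have : x 0 ≤ 1 := by
      refine closure_minimal (fun y hy => ?_) hcl hx
      by_contra hy0
      exact hy (by simp [hu, Real.smoothTransition.one_of_one_le (not_le.1 hy0).le])
    linarith
  have hPv : kleinGordonFun m (u - w) = kleinGordonFun m u := funext fun x => by
    rw [kleinGordonFun_sub m hus hw, hP, Pi.zero_apply, sub_zero]
  have hαs := contDiff_kleinGordonFun m hus
  have hα : kleinGordonFun m u ∈ TimelikeCompactOdd := by
    refine ⟨⟨hαs, isTimelikeCompact_iff.2 ⟨?_, ?_⟩⟩, hαs, kleinGordonFun_odd m hus huodd⟩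
    · exact cu.mono (isClosed_tsupport _) (tsupport_kleinGordonFun_subset m u)
    · rw [← hPv]
      exact cv.mono (isClosed_tsupport _) (tsupport_kleinGordonFun_subset m _)
  refine ⟨⟨_, hα⟩, ?_⟩
  rw [causalPropagator_eq hus cu rfl hvs cv hPv, sub_sub_cancel]

theorem bijOn_imagesMap (m : ℝ) :
    BijOn (imagesMap m) univ (dynamicalConfigurations m) := by
  refine ⟨fun q _ => ?_, ?_, ?_⟩
  · obtain ⟨α, rfl⟩ := Submodule.mkQ_surjective _ q
    exact imagesOperator_mem m (inclTC α)
  · exact (LinearMap.ker_eq_bot.1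
      (Submodule.ker_liftQ_eq_bot _ _ (range_le_ker m) (ker_imagesOperator_le m))).injOn
  · rintro u ⟨⟨O, v, hv, hP⟩, hu0⟩
    obtain ⟨v', hv's, hv'v, hv'P⟩ := exists_contDiff_extension hv.isOpen hv.subset hv.contDiffOn hP
    have h0 : ∀ x : Spacetime, x 3 = 0 → v' x = 0 := fun x hx => by
      have hxH : x ∈ halfSpace := le_of_eq hx.symm
      rw [hv'v x hxH, hv.eq ⟨x, hxH⟩]
      exact hu0 ⟨x, hxH⟩ hx
    obtain ⟨α, hα⟩ := exists_causalPropagator_eq (contDiff_reflectExt hv's hv'P h0)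
      (kleinGordonFun_reflectExt hv's hv'P h0) (reflectExt_neg_one_odd h0)
    refine ⟨(LinearMap.range (kleinGordonTCOdd m)).mkQ ((1 / 2 : ℝ) • α), mem_univ _, ?_⟩
    change imagesOperator m (inclTC ((1 / 2 : ℝ) • α)) = u
    funext x
    rw [map_smul, map_smul, Pi.smul_apply, imagesOperator_apply, hα,
      reflectExt_of_nonneg _ _ x.2, hv'v x x.2, hv.eq, smul_eq_mul]
    ring

end CasimirPolder

end

theorem proposition2p1 (m : ℝ) (hm : 0 ≤ m) :
    (∃! G, CasimirPolder.IsFundamentalPair m G) ∧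
      Set.BijOn (CasimirPolder.imagesMap m) Set.univ (CasimirPolder.dynamicalConfigurations m) :=
  ⟨CasimirPolder.existsUnique_isFundamentalPair m, CasimirPolder.bijOn_imagesMap m⟩
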